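/- **Proposition.** All vector spaces are over $\mathbb C$. Let $\mathfrak g$ be a finite-dimensional simple Lie superalgebra, $A$ a finitely generated, associative, commutative, unital $\mathbb C$-algebra, and $\Gamma$ a finite abelian group acting on $\mathfrak g$ and on $A$ by automorphisms, such that the induced action $\gamma\mathsf m=\{\gamma a: a\in\mathsf m\}$ of $\Gamma$ on the set of maximal ideals of $A$ is free. Let $\Gamma$ act on $\mathfrak g\otimes A$ by $\gamma(x\otimes a)=\gamma x\otimes\gamma a$, and let $(\mathfrak g\otimes A)^\Gamma$ be the Lie subsuperalgebra of fixed points. Let $\ell,n_1,\dots,n_\ell$ be positive integers, let $\mathsf m_1,\dots,\mathsf m_\ell$ be maximal ideals of $A$ in pairwise distinct $\Gamma$-orbits, and for each $i$ let $M_i$ be a finite-dimensional ($\mathbb Z_2$-graded) $\mathfrak g\otimes A/\mathsf m_i^{n_i}$-module. Let $\mathrm{ev}^\Gamma_{\mathsf m_i^{n_i}}M_i$ be the $(\mathfrak g\otimes A)^\Gamma$-module obtained from $M_i$ by pull-back along the homomorphism $(\mathfrak g\otimes A)^\Gamma\hookrightarrow\mathfrak g\otimes A\to\mathfrak g\otimes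 A/\mathsf m_i^{n_i}$, and let $$M=\bigotimes_{i=1}^{\ell}\mathrm{ev}^\Gamma_{\mathsf m_i^{n_i}}M_i .$$ If $\mathrm{Hom}_{\mathfrak g\otimes A/\mathsf m_i^{n_i}}(\mathbb C,M_i)=0$ for more than one index $i$, then $$H^1\big((\mathfrak g\otimes A)^\Gamma,M\big)=0 .$$ Here $\mathbb C$ is the trivial module, $\mathrm{Hom}$ consists of all module homomorphisms (sums of even and odd ones), and for a Lie superalgebra $L$ and an $L$-module $V$, $H^1(L,V)$ is the degree-one cohomology, even and odd parts together, of the complex $$V\xrightarrow{d^0}\mathrm{Hom}_{\mathbb C}(L,V)\xrightarrow{d^1}\mathrm{Hom}_{\mathbb C}(\Lambda^2L,V),$$ with $(d^0v)(x)=xv$ and $(d^1f)(x\wedge y)=x f(y)-(-1)^{|x||y|}\,y f(x)-f([x,y])$ for homogeneous $x,y\in L$. -/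

import Mathlib

open scoped TensorProduct

namespace EquivMap

noncomputable section

/-! ### Super spaces -/

/-- A super space: a complex vector space `V = V₀ ⊕ V₁`, graded by `ZMod 2`. -/
class SuperSpace (V : Type*) [AddCommGroup V] [Module ℂ V] where
  part : ZMod 2 → Submodule ℂ V
  isCompl : IsCompl (part 0) (part 1)

open SuperSpace (part)

/-- The Koszul sign `(-1)^{ij}` for parities `i, j`. -/
def sgn (i j : ZMod 2) : ℂ := (-1) ^ (i.val * j.val)

theorem zmod_cases (z : ZMod 2) : z = 0 ∨ z = 1 := by
  revert z; decide

@[simp] theorem sgn_zero_left (j : ZMod 2) : sgn 0 j = 1 := by simp [sgn]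

@[simp] theorem sgn_zero_right (j : ZMod 2) : sgn j 0 = 1 := by simp [sgn]

@[simp] theorem sgn_one_one : sgn 1 1 = -1 := by simp [sgn, ZMod.val_one]

theorem one_add_one : (1 + 1 : ZMod 2) = 0 := by decide

theorem sgn_comm (i j : ZMod 2) : sgn i j = sgn j i := by
  simp [sgn, mul_comm]

theorem sgn_add_left (i j k : ZMod 2) : sgn (i + j) k = sgn i k * sgn j k := by
  rcases zmod_cases i with rfl | rfl <;> rcases zmod_cases j with rfl | rfl <;>
    rcases zmod_cases k with rfl | rfl <;> simp [one_add_one]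

theorem sgn_add_right (i j k : ZMod 2) : sgn i (j + k) = sgn i j * sgn i k := by
  rw [sgn_comm, sgn_add_left, sgn_comm j, sgn_comm k]

theorem sgn_mul_self (i j : ZMod 2) : sgn i j * sgn i j = 1 := by
  rcases zmod_cases i with rfl | rfl <;> rcases zmod_cases j with rfl | rfl <;> simp

/-- A pair of subspaces spanning `V`, on which a linear map acts as `1` and `-1`, is a
`ZMod 2`-grading. -/
theorem isCompl_of_involution {V : Type*} [AddCommGroup V] [Module ℂ V]
    {p q : Submodule ℂ V} (σ : V →ₗ[ℂ] V) (hp : ∀ v ∈ p, σ v = v) (hq : ∀ v ∈ q, σ v = -v)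
    (h : ⊤ ≤ p ⊔ q) : IsCompl p q := by
  refine ⟨Submodule.disjoint_def.2 fun v h1 h2 => ?_, codisjoint_iff_le_sup.2 h⟩
  have h3 : v = -v := (hp v h1).symm.trans (hq v h2)
  have h4 : (2 : ℂ) • v = 0 := by
    rw [two_smul]; nth_rewrite 2 [h3]; simp
  simpa using h4

section Proj

variable {V : Type*} [AddCommGroup V] [Module ℂ V] [SuperSpace V]

theorem isCompl_part (z : ZMod 2) : IsCompl (part (V := V) z) (part (z + 1)) := by
  rcases zmod_cases z with rfl | rfl
  · simpa using SuperSpace.isCompl (V := V)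
  · simpa [one_add_one] using (SuperSpace.isCompl (V := V)).symm

/-- The projection of a super space onto its component of parity `z`. -/
def proj (z : ZMod 2) : V →ₗ[ℂ] V := Submodule.projection _ _ (isCompl_part (V := V) z)

theorem proj_mem (z : ZMod 2) (v : V) : proj z v ∈ part (V := V) z := by
  simp [proj]

theorem proj_of_mem {z : ZMod 2} {v : V} (h : v ∈ part (V := V) z) : proj z v = v := by
  simpa [proj] using h

theorem proj_of_mem_ne {z w : ZMod 2} (hzw : z ≠ w) {v : V} (h : v ∈ part (V := V) w) :
    proj z v = 0 := by
  have : w = z + 1 := by clear h; revert z w; decide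
  subst this
  simpa [proj] using h

theorem proj_add_proj (v : V) : proj 0 v + proj 1 v = v := by
  have h : v ∈ part (V := V) 0 ⊔ part 1 := by
    rw [(SuperSpace.isCompl (V := V)).sup_eq_top]; trivial
  obtain ⟨a, ha, b, hb, rfl⟩ := Submodule.mem_sup.1 h
  simp [proj_of_mem ha, proj_of_mem hb, proj_of_mem_ne (zero_ne_one) hb,
    proj_of_mem_ne (one_ne_zero) ha]

/-- Linear maps that agree on homogeneous elements are equal. -/
theorem hom_ext {W : Type*} [AddCommGroup W] [Module ℂ W] {f g : V →ₗ[ℂ] W}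
    (h : ∀ z, ∀ v ∈ part (V := V) z, f v = g v) : f = g := by
  ext v
  rw [← proj_add_proj v, map_add, map_add, h 0 _ (proj_mem 0 v), h 1 _ (proj_mem 1 v)]

/-- The operator which multiplies a homogeneous vector `v` by `(-1)^{z|v|}`. -/
def signOp (z : ZMod 2) : Module.End ℂ V := proj 0 + sgn z 1 • proj 1

theorem signOp_of_mem (z : ZMod 2) {w : ZMod 2} {v : V} (h : v ∈ part (V := V) w) :
    signOp z v = sgn z w • v := by
  rcases zmod_cases w with rfl | rfl
  · simp [signOp, proj_of_mem h, proj_of_mem_ne (one_ne_zero) h]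
  · simp [signOp, proj_of_mem h, proj_of_mem_ne (zero_ne_one) h]

theorem signOp_mul (z w : ZMod 2) : (signOp z * signOp w : Module.End ℂ V) = signOp (z + w) := by
  refine hom_ext fun i v hv => ?_
  simp [Module.End.mul_apply, signOp_of_mem _ hv, sgn_add_left, smul_smul, mul_comm]

end Proj

/-- The ground field, as a super space concentrated in even degree. -/
instance : SuperSpace ℂ where
  part z := if z = 0 then ⊤ else ⊥
  isCompl := by simpa using isCompl_top_bot

/-- The tensor product of a super space with an (even) vector space:
`(V ⊗ B)_z = V_z ⊗ B`. -/
instance tensorSuperSpace (V B : Type*) [AddCommGroup V] [Module ℂ V] [SuperSpace V]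
    [AddCommGroup B] [Module ℂ B] : SuperSpace (V ⊗[ℂ] B) where
  part z := Submodule.map₂ (TensorProduct.mk ℂ V B) (part z) ⊤
  isCompl := by
    refine isCompl_of_involution (TensorProduct.map (signOp 1) LinearMap.id) ?_ ?_ ?_
    · refine fun v hv => (Submodule.map₂_le (f := TensorProduct.mk ℂ V B) (r := LinearMap.eqLocus
        (TensorProduct.map (signOp 1) LinearMap.id) LinearMap.id)).2 ?_ hv
      intro m hm n _
      simp [signOp_of_mem 1 hm]
    · refine fun v hv => (Submodule.map₂_le (f := TensorProduct.mk ℂ V B) (r := LinearMap.eqLocus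
        (TensorProduct.map (signOp 1) LinearMap.id) (-LinearMap.id))).2 ?_ hv
      intro m hm n _
      simp [signOp_of_mem 1 hm, TensorProduct.neg_tmul]
    · rw [← Submodule.map₂_sup_left, (SuperSpace.isCompl (V := V)).sup_eq_top,
        TensorProduct.map₂_mk_top_top_eq_top]

theorem tmul_mem_part {V B : Type*} [AddCommGroup V] [Module ℂ V] [SuperSpace V]
    [AddCommGroup B] [Module ℂ B] {z : ZMod 2} {v : V} (hv : v ∈ part (V := V) z) (b : B) :
    v ⊗ₜ[ℂ] b ∈ part (V := V ⊗[ℂ] B) z :=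
  Submodule.apply_mem_map₂ _ hv Submodule.mem_top

/-- To show that a linear map sends `(V ⊗ B)_z` into a subspace, pure tensors are enough. -/
theorem part_tensor_le {V B : Type*} [AddCommGroup V] [Module ℂ V] [SuperSpace V]
    [AddCommGroup B] [Module ℂ B] {z : ZMod 2} {q : Submodule ℂ (V ⊗[ℂ] B)}
    (h : ∀ v ∈ part (V := V) z, ∀ b : B, v ⊗ₜ[ℂ] b ∈ q) : part (V := V ⊗[ℂ] B) z ≤ q :=
  Submodule.map₂_le.2 fun v hv b _ => h v hv b

/-- The tensor product of finitely many super spaces, with parities added. -/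
instance piTensorSuperSpace {ι : Type*} [Fintype ι] (V : ι → Type*)
    [∀ i, AddCommGroup (V i)] [∀ i, Module ℂ (V i)] [∀ i, SuperSpace (V i)] :
    SuperSpace (⨂[ℂ] i, V i) where
  part z := Submodule.span ℂ {t | ∃ (d : ι → ZMod 2) (v : ∀ i, V i),
    (∀ i, v i ∈ part (V := V i) (d i)) ∧ ∑ i, d i = z ∧ t = PiTensorProduct.tprod ℂ v}
  isCompl := by
    classical
    have key : ∀ (d : ι → ZMod 2) (v : ∀ i, V i), (∀ i, v i ∈ part (V := V i) (d i)) →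
        PiTensorProduct.map (fun i => (signOp 1 : Module.End ℂ (V i)))
          (PiTensorProduct.tprod ℂ v) = sgn 1 (∑ i, d i) • PiTensorProduct.tprod ℂ v := by
      intro d v hv
      have h1 : sgn 1 (∑ i, d i) = ∏ i, sgn 1 (d i) := by
        induction (Finset.univ : Finset ι) using Finset.induction_on with
        | empty => simp
        | insert a s ha ih => rw [Finset.sum_insert ha, Finset.prod_insert ha, sgn_add_right, ih]
      rw [PiTensorProduct.map_tprod, h1, ← MultilinearMap.map_smul_univ]
      congr 1
      ext i
      exact signOp_of_mem 1 (hv i)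
    refine isCompl_of_involution
      (PiTensorProduct.map (fun i => (signOp 1 : Module.End ℂ (V i)))) ?_ ?_ ?_
    · refine fun v hv => Submodule.span_le (p := LinearMap.eqLocus
        (PiTensorProduct.map (fun i => (signOp 1 : Module.End ℂ (V i)))) LinearMap.id) |>.2 ?_ hv
      rintro _ ⟨d, v, hv, hd, rfl⟩
      simp [key d v hv, hd]
    · refine fun v hv => Submodule.span_le (p := LinearMap.eqLocus
        (PiTensorProduct.map (fun i => (signOp 1 : Module.End ℂ (V i))))
          (-LinearMap.id)) |>.2 ?_ hv
      rintro _ ⟨d, v, hv, hd, rfl⟩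
      simp [key d v hv, hd]
    · rw [← PiTensorProduct.span_tprod_eq_top, Submodule.span_le]
      rintro _ ⟨v, rfl⟩
      have hv : v = fun i => ∑ z : ZMod 2, proj z (v i) := by
        ext i
        exact ((Fin.sum_univ_two (fun z : ZMod 2 => proj z (v i))).trans
          (proj_add_proj (v i))).symm
      rw [hv, MultilinearMap.map_sum]
      refine Submodule.sum_mem _ fun d _ => ?_
      rcases zmod_cases (∑ i, d i) with h | h
      · exact Submodule.mem_sup_left (Submodule.subset_span
          ⟨d, _, fun i => proj_mem (d i) (v i), h, rfl⟩)
      · exact Submodule.mem_sup_right (Submodule.subset_span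
          ⟨d, _, fun i => proj_mem (d i) (v i), h, rfl⟩)

/-! ### Lie superalgebras -/

/-- A complex Lie superalgebra. The identities are imposed on homogeneous elements. -/
class LieSuperalgebra (L : Type*) [AddCommGroup L] [Module ℂ L] extends SuperSpace L where
  bracket : L →ₗ[ℂ] L →ₗ[ℂ] L
  bracket_mem : ∀ {i j : ZMod 2} {x y : L}, x ∈ part i → y ∈ part j →
    bracket x y ∈ part (i + j)
  skew : ∀ {i j : ZMod 2} {x y : L}, x ∈ part i → y ∈ part j →
    bracket x y = -(sgn i j • bracket y x)
  jacobi : ∀ {i j : ZMod 2} {x y : L}, x ∈ part i → y ∈ part j → ∀ w : L,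
    bracket x (bracket y w) = bracket (bracket x y) w + sgn i j • bracket y (bracket x w)

open LieSuperalgebra (bracket)

/-- Simplicity: the bracket is nonzero, and every graded ideal is `0` or everything. -/
def IsSimple (L : Type*) [AddCommGroup L] [Module ℂ L] [LieSuperalgebra L] : Prop :=
  (∃ x y : L, bracket x y ≠ 0) ∧
    ∀ I : Submodule ℂ L, (∀ z, ∀ x ∈ I, proj z x ∈ I) → (∀ x, ∀ y ∈ I, bracket x y ∈ I) →
      I = ⊥ ∨ I = ⊤

/-- Homomorphisms of Lie superalgebras: even linear maps that preserve the brackets. -/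
structure LieSuperHom (L L' : Type*) [AddCommGroup L] [Module ℂ L] [LieSuperalgebra L]
    [AddCommGroup L'] [Module ℂ L'] [LieSuperalgebra L'] where
  toLinearMap : L →ₗ[ℂ] L'
  map_mem : ∀ {z : ZMod 2} {x : L}, x ∈ part z → toLinearMap x ∈ part z
  map_bracket : ∀ x y : L, toLinearMap (bracket x y) = bracket (toLinearMap x) (toLinearMap y)

/-- The group of automorphisms of a Lie superalgebra. -/
def LieSuperAut (L : Type*) [AddCommGroup L] [Module ℂ L] [LieSuperalgebra L] :
    Subgroup (L ≃ₗ[ℂ] L) where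
  carrier := {φ | (∀ z x, φ x ∈ part (V := L) z ↔ x ∈ part (V := L) z) ∧
    ∀ x y : L, φ (bracket x y) = bracket (φ x) (φ y)}
  mul_mem' := by
    rintro φ ψ ⟨h1, h2⟩ ⟨h3, h4⟩
    exact ⟨fun z x => (h1 z _).trans (h3 z x), fun x y => by
      simp [LinearEquiv.mul_apply, h2, h4]⟩
  one_mem' := ⟨fun _ _ => Iff.rfl, fun _ _ => rfl⟩
  inv_mem' := by
    rintro φ ⟨h1, h2⟩
    refine ⟨fun z x => ?_, fun x y => ?_⟩
    · have := h1 z (φ⁻¹ x)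
      rw [show φ (φ⁻¹ x) = x from φ.apply_symm_apply x] at this
      exact this.symm
    · apply φ.injective
      rw [h2, show φ (φ⁻¹ _) = _ from φ.apply_symm_apply _,
        show φ (φ⁻¹ x) = x from φ.apply_symm_apply x,
        show φ (φ⁻¹ y) = y from φ.apply_symm_apply y]

/-! ### Representations -/

/-- A representation of a Lie superalgebra `L` on a super space `V`; that is, an `L`-module. -/
structure SuperRep (L : Type*) [AddCommGroup L] [Module ℂ L] [LieSuperalgebra L]
    (V : Type*) [AddCommGroup V] [Module ℂ V] [SuperSpace V] where
  act : L →ₗ[ℂ] Module.End ℂ V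
  act_mem : ∀ {i j : ZMod 2} {x : L} {v : V}, x ∈ part i → v ∈ part j →
    act x v ∈ part (i + j)
  act_bracket : ∀ {i j : ZMod 2} {x y : L}, x ∈ part i → y ∈ part j →
    act (bracket x y) = act x * act y - sgn i j • (act y * act x)

section Rep

variable {L : Type*} [AddCommGroup L] [Module ℂ L] [LieSuperalgebra L]
  {V : Type*} [AddCommGroup V] [Module ℂ V] [SuperSpace V]
  {W : Type*} [AddCommGroup W] [Module ℂ W] [SuperSpace W]

/-- The trivial one-dimensional module. -/
def trivialRep (L : Type*) [AddCommGroup L] [Module ℂ L] [LieSuperalgebra L] :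
    SuperRep L ℂ where
  act := 0
  act_mem := by intros; simp
  act_bracket := by intros; simp

/-- The pull-back of a representation along a homomorphism of Lie superalgebras. -/
def SuperRep.pullback {L' : Type*} [AddCommGroup L'] [Module ℂ L'] [LieSuperalgebra L']
    (ρ : SuperRep L' V) (φ : LieSuperHom L L') : SuperRep L V where
  act := ρ.act ∘ₗ φ.toLinearMap
  act_mem hx hv := ρ.act_mem (φ.map_mem hx) hv
  act_bracket hx hy := by
    simp only [LinearMap.comp_apply, φ.map_bracket]
    exact ρ.act_bracket (φ.map_mem hx) (φ.map_mem hy)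

/-- Homomorphisms of `L`-modules `V → W` which are homogeneous of parity `z`:
`f (x v) = (-1)^{z|x|} x f(v)`. -/
def homPart (ρ : SuperRep L V) (τ : SuperRep L W) (z : ZMod 2) : Submodule ℂ (V →ₗ[ℂ] W) where
  carrier := {f | (∀ j, ∀ v ∈ part (V := V) j, f v ∈ part (V := W) (z + j)) ∧
    ∀ i, ∀ x ∈ part (V := L) i, ∀ v, f (ρ.act x v) = sgn z i • τ.act x (f v)}
  zero_mem' := by simp
  add_mem' := by
    rintro f g ⟨h1, h2⟩ ⟨h3, h4⟩
    refine ⟨fun j v hv => add_mem (h1 j v hv) (h3 j v hv), fun i x hx v => ?_⟩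
    simp [h2 i x hx v, h4 i x hx v]
  smul_mem' := by
    rintro c f ⟨h1, h2⟩
    refine ⟨fun j v hv => Submodule.smul_mem _ _ (h1 j v hv), fun i x hx v => ?_⟩
    simp [h2 i x hx v, smul_comm c]

/-- The super space `Hom_L(V, W)` of all homomorphisms of `L`-modules, that is, of sums of
even and odd ones. -/
def moduleHom (ρ : SuperRep L V) (τ : SuperRep L W) : Submodule ℂ (V →ₗ[ℂ] W) :=
  homPart ρ τ 0 ⊔ homPart ρ τ 1

/-! ### Cohomology in degree one -/

/-- `Hom(Λ²L, V)`: bilinear maps on `L` that are alternating in the super sense. -/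
def cochains₂ (L V : Type*) [AddCommGroup L] [Module ℂ L] [SuperSpace L]
    [AddCommGroup V] [Module ℂ V] : Submodule ℂ (L →ₗ[ℂ] L →ₗ[ℂ] V) where
  carrier := {B | ∀ i j : ZMod 2, ∀ x ∈ part (V := L) i, ∀ y ∈ part (V := L) j,
    B x y = -(sgn i j • B y x)}
  zero_mem' := by simp
  add_mem' := by
    intro B C hB hC i j x hx y hy
    simp only [LinearMap.add_apply, hB i j x hx y hy, hC i j x hx y hy, smul_add]
    abel
  smul_mem' := by
    intro c B hB i j x hx y hy
    simp only [LinearMap.smul_apply, hB i j x hx y hy, smul_neg]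
    rw [smul_comm]

/-- The differential `d⁰ : V → Hom(L, V)`, `(d⁰ v)(x) = x v`. -/
def d₀ (ρ : SuperRep L V) : V →ₗ[ℂ] (L →ₗ[ℂ] V) := ρ.act.flip

/-- The bilinear map `(x, y) ↦ (-1)^{|x||y|} y f(x)`. -/
def twistedAct (ρ : SuperRep L V) (f : L →ₗ[ℂ] V) : L →ₗ[ℂ] L →ₗ[ℂ] V :=
  ∑ i : ZMod 2, ∑ j : ZMod 2,
    sgn i j • (ρ.act.flip ∘ₗ f ∘ₗ proj i).compl₂ (proj j)

theorem twistedAct_apply (ρ : SuperRep L V) (f : L →ₗ[ℂ] V) {i j : ZMod 2} {x y : L}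
    (hx : x ∈ part (V := L) i) (hy : y ∈ part (V := L) j) :
    twistedAct ρ f x y = sgn i j • ρ.act y (f x) := by
  simp only [twistedAct, LinearMap.sum_apply, LinearMap.smul_apply, LinearMap.compl₂_apply,
    LinearMap.comp_apply, LinearMap.flip_apply]
  rw [Finset.sum_eq_single i, Finset.sum_eq_single j, proj_of_mem hx, proj_of_mem hy]
  · intro b _ hb; simp [proj_of_mem_ne hb hy]
  · simp
  · intro b _ hb; simp [proj_of_mem_ne hb hx]
  · simp

/-- The bilinear map underlying `d¹ f`. -/
def d₁Fun (ρ : SuperRep L V) (f : L →ₗ[ℂ] V) : L →ₗ[ℂ] L →ₗ[ℂ] V :=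
  ρ.act.compl₂ f - twistedAct ρ f - bracket.compr₂ f

theorem d₁Fun_apply (ρ : SuperRep L V) (f : L →ₗ[ℂ] V) {i j : ZMod 2} {x y : L}
    (hx : x ∈ part (V := L) i) (hy : y ∈ part (V := L) j) :
    d₁Fun ρ f x y = ρ.act x (f y) - sgn i j • ρ.act y (f x) - f (bracket x y) := by
  simp [d₁Fun, twistedAct_apply ρ f hx hy]

/-- The differential `d¹ : Hom(L, V) → Hom(Λ²L, V)`,
`(d¹ f)(x, y) = x f(y) - (-1)^{|x||y|} y f(x) - f([x, y])` for homogeneous `x, y`. -/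
def d₁ (ρ : SuperRep L V) : (L →ₗ[ℂ] V) →ₗ[ℂ] cochains₂ L V where
  toFun f := ⟨d₁Fun ρ f, by
    intro i j x hx y hy
    rw [d₁Fun_apply ρ f hx hy, d₁Fun_apply ρ f hy hx, LieSuperalgebra.skew hx hy, sgn_comm j i]
    simp only [smul_sub, smul_smul, sgn_mul_self, one_smul, map_neg, map_smul]
    abel⟩
  map_add' f g := by
    refine Subtype.ext (hom_ext fun i x hx => hom_ext fun j y hy => ?_)
    simp only [Submodule.coe_add, LinearMap.add_apply, d₁Fun_apply ρ _ hx hy, map_add, smul_add]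
    abel
  map_smul' c f := by
    refine Subtype.ext (hom_ext fun i x hx => hom_ext fun j y hy => ?_)
    simp only [Submodule.coe_smul, LinearMap.smul_apply, d₁Fun_apply ρ _ hx hy, map_smul,
      smul_sub, RingHom.id_apply, smul_comm c]

theorem d₁_d₀ (ρ : SuperRep L V) (v : V) : d₁ ρ (d₀ ρ v) = 0 := by
  refine Subtype.ext (hom_ext fun i x hx => hom_ext fun j y hy => ?_)
  change d₁Fun ρ (d₀ ρ v) x y = 0
  rw [d₁Fun_apply ρ _ hx hy]
  simp [d₀, ρ.act_bracket hx hy, Module.End.mul_apply]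

/-- The coboundaries, as a subspace of the cocycles. -/
def coboundaries₁ (ρ : SuperRep L V) : Submodule ℂ (LinearMap.ker (d₁ ρ)) :=
  LinearMap.range ((d₀ ρ).codRestrict (LinearMap.ker (d₁ ρ)) (d₁_d₀ ρ))

/-- The first cohomology `H¹(L, V) = ker d¹ / im d⁰` (its even and odd parts together). -/
abbrev H1 (ρ : SuperRep L V) : Type _ := LinearMap.ker (d₁ ρ) ⧸ coboundaries₁ ρ

end Rep

/-! ### Tensor products of representations -/

section Tensor

variable {L : Type*} [AddCommGroup L] [Module ℂ L] [LieSuperalgebra L] {ℓ : ℕ}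
  {V : Fin ℓ → Type*} [∀ i, AddCommGroup (V i)] [∀ i, Module ℂ (V i)] [∀ i, SuperSpace (V i)]

/-- The operator `v₁ ⊗ ⋯ ⊗ v_ℓ ↦ (-1)^{z(|v₁| + ⋯ + |v_{k-1}|)} v₁ ⊗ ⋯ ⊗ a v_k ⊗ ⋯ ⊗ v_ℓ`,
as a linear function of the operator `a` on `V k`. -/
def slot (z : ZMod 2) (k : Fin ℓ) : Module.End ℂ (V k) →ₗ[ℂ] Module.End ℂ (⨂[ℂ] i, V i) :=
  (PiTensorProduct.mapMultilinear ℂ V V).toLinearMap (fun j => if j < k then signOp z else 1) k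

theorem slot_apply (z : ZMod 2) (k : Fin ℓ) (a : Module.End ℂ (V k)) :
    slot z k a = PiTensorProduct.map
      (Function.update (fun j => if j < k then (signOp z : Module.End ℂ (V j)) else 1) k a) :=
  rfl

theorem slot_mul_same (z w : ZMod 2) (k : Fin ℓ) (a b : Module.End ℂ (V k)) :
    slot z k a * slot w k b = slot (z + w) k (a * b) := by
  simp only [slot_apply]
  rw [← PiTensorProduct.map_mul]
  congr 1
  ext1 j
  by_cases h : j = k
  · subst h; simp
  · by_cases h' : j < k <;> simp [h, h', signOp_mul]

theorem slot_comm_of_lt (z w : ZMod 2) {k l : Fin ℓ} (hkl : k < l) (a : Module.End ℂ (V k))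
    (b : Module.End ℂ (V l)) (ha : signOp w * a = sgn z w • (a * signOp w)) :
    slot w l b * slot z k a = sgn z w • (slot z k a * slot w l b) := by
  simp only [slot_apply]
  rw [← PiTensorProduct.map_mul, ← PiTensorProduct.map_mul]
  rw [← Function.update_eq_self k (fun i => Function.update
      (fun j => if j < k then (signOp z : Module.End ℂ (V j)) else 1) k a i *
      Function.update (fun j => if j < l then (signOp w : Module.End ℂ (V j)) else 1) l b i),
    ← PiTensorProduct.map_update_smul]
  congr 1
  ext1 j
  by_cases h : j = k
  · subst h
    simp [hkl.ne, hkl, ha]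
  · by_cases h' : j = l
    · subst h'
      simp [h, not_lt_of_gt hkl]
    · by_cases h1 : j < k
      · simp [h, h', h1, h1.trans hkl, signOp_mul, add_comm]
      · by_cases h2 : j < l <;> simp [h, h', h1, h2]

/-- The tensor product of representations: for homogeneous `x` and `v_i`,
`x (v₁ ⊗ ⋯ ⊗ v_ℓ) = ∑ k, (-1)^{|x|(|v₁| + ⋯ + |v_{k-1}|)} v₁ ⊗ ⋯ ⊗ x v_k ⊗ ⋯ ⊗ v_ℓ`. -/
def tensorAct (ρ : ∀ i, SuperRep L (V i)) : L →ₗ[ℂ] Module.End ℂ (⨂[ℂ] i, V i) :=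
  ∑ z : ZMod 2, ∑ k : Fin ℓ, slot z k ∘ₗ (ρ k).act ∘ₗ proj z

theorem tensorAct_apply (ρ : ∀ i, SuperRep L (V i)) {z : ZMod 2} {x : L}
    (hx : x ∈ part (V := L) z) : tensorAct ρ x = ∑ k, slot z k ((ρ k).act x) := by
  simp only [tensorAct, LinearMap.sum_apply, LinearMap.comp_apply]
  rw [Finset.sum_eq_single z, proj_of_mem hx]
  · intro b _ hb; simp [proj_of_mem_ne hb hx]
  · simp

theorem signOp_mul_act {V : Type*} [AddCommGroup V] [Module ℂ V] [SuperSpace V]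
    (ρ : SuperRep L V) {z : ZMod 2} {x : L} (hx : x ∈ part (V := L) z) (w : ZMod 2) :
    signOp w * ρ.act x = sgn z w • (ρ.act x * signOp w) := by
  refine hom_ext fun i v hv => ?_
  simp [Module.End.mul_apply, signOp_of_mem w (ρ.act_mem hx hv), signOp_of_mem w hv,
    sgn_add_right, smul_smul, sgn_comm w z]

theorem sum_add_parity (d : Fin ℓ → ZMod 2) (k : Fin ℓ) (z : ZMod 2) :
    ∑ j, Function.update d k (z + d k) j = z + ∑ j, d j := by
  rw [Finset.sum_update_of_mem (Finset.mem_univ k), add_assoc]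
  congr 1
  rw [Finset.sdiff_singleton_eq_erase, Finset.add_sum_erase _ _ (Finset.mem_univ k)]

/-- The tensor product `V₁ ⊗ ⋯ ⊗ V_ℓ` of `L`-modules. -/
def tensorRep (ρ : ∀ i, SuperRep L (V i)) : SuperRep L (⨂[ℂ] i, V i) where
  act := tensorAct ρ
  act_mem := by
    intro z w x t hx ht
    refine Submodule.span_le (p := (part (V := ⨂[ℂ] i, V i) (z + w)).comap
      (tensorAct ρ x)) |>.2 ?_ ht
    rintro _ ⟨d, v, hv, hd, rfl⟩
    rw [SetLike.mem_coe, Submodule.mem_comap, tensorAct_apply ρ hx, LinearMap.sum_apply]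
    refine Submodule.sum_mem _ fun k _ => ?_
    rw [slot_apply, PiTensorProduct.map_tprod]
    refine Submodule.subset_span ⟨Function.update d k (z + d k), _, fun j => ?_, ?_, rfl⟩
    · by_cases h : j = k
      · subst h
        simpa using (ρ j).act_mem hx (hv j)
      · by_cases h' : j < k
        · simpa [h, h', signOp_of_mem z (hv j)] using Submodule.smul_mem _ _ (hv j)
        · simpa [h, h'] using hv j
    · rw [sum_add_parity, hd]
  act_bracket := by
    intro i j x y hx hy
    rw [tensorAct_apply ρ hx, tensorAct_apply ρ hy,
      tensorAct_apply ρ (LieSuperalgebra.bracket_mem hx hy), Finset.sum_mul_sum,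
      Finset.sum_mul_sum, Finset.sum_comm (f := fun a b => slot j a ((ρ a).act y) * _),
      Finset.smul_sum, ← Finset.sum_sub_distrib]
    refine Finset.sum_congr rfl fun k _ => ?_
    rw [Finset.smul_sum, ← Finset.sum_sub_distrib, Finset.sum_eq_single k]
    · rw [slot_mul_same, slot_mul_same, add_comm j i, (ρ k).act_bracket hx hy, map_sub, map_smul]
    · intro l _ hl
      rcases lt_or_gt_of_ne hl with h | h
      · rw [slot_comm_of_lt j i h _ _ (signOp_mul_act (ρ l) hy i), sgn_comm j i, sub_self]
      · rw [slot_comm_of_lt i j h _ _ (signOp_mul_act (ρ k) hx j), smul_smul, sgn_mul_self,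
          one_smul, sub_self]
    · simp

end Tensor

/-! ### Equivariant map superalgebras -/

section Map

variable (g : Type*) [AddCommGroup g] [Module ℂ g] [LieSuperalgebra g]

/-- The map superalgebra `g ⊗ B`, with `[x ⊗ a, y ⊗ b] = [x, y] ⊗ ab`. -/
instance mapSuperalgebra (B : Type*) [CommRing B] [Algebra ℂ B] : LieSuperalgebra (g ⊗[ℂ] B) where
  toSuperSpace := tensorSuperSpace g B
  bracket := TensorProduct.map₂ bracket (LinearMap.mul ℂ B)
  bracket_mem := by
    intro i j x y hx hy
    have h1 : part (V := g ⊗[ℂ] B) i ≤ (⨅ y ∈ part (V := g ⊗[ℂ] B) j,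
        (part (V := g ⊗[ℂ] B) (i + j)).comap
          ((TensorProduct.map₂ bracket (LinearMap.mul ℂ B)).flip y)) := by
      refine part_tensor_le fun v hv b => ?_
      simp only [Submodule.mem_iInf, Submodule.mem_comap, LinearMap.flip_apply]
      intro y hy
      refine (part_tensor_le (q := (part (V := g ⊗[ℂ] B) (i + j)).comap
        (TensorProduct.map₂ bracket (LinearMap.mul ℂ B) (v ⊗ₜ b))) fun u hu c => ?_) hy
      exact tmul_mem_part (LieSuperalgebra.bracket_mem hv hu) _
    have h2 := h1 hx
    simp only [Submodule.mem_iInf, Submodule.mem_comap, LinearMap.flip_apply] at h2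
    exact h2 y hy
  skew := by
    intro i j x y hx hy
    let T := TensorProduct.map₂ (bracket (L := g)) (LinearMap.mul ℂ B)
    suffices h : ∀ v ∈ part (V := g) i, ∀ b : B, T (v ⊗ₜ b) y = -(sgn i j • T y (v ⊗ₜ b)) from
      part_tensor_le (q := LinearMap.eqLocus (T.flip y) (-(sgn i j • T y))) h hx
    intro v hv b
    refine part_tensor_le (q := LinearMap.eqLocus (T (v ⊗ₜ b))
      (-(sgn i j • T.flip (v ⊗ₜ b)))) (fun u hu c => ?_) hy
    change T (v ⊗ₜ b) (u ⊗ₜ c) = -(sgn i j • T (u ⊗ₜ c) (v ⊗ₜ b))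
    simp only [T, TensorProduct.map₂_apply_tmul, TensorProduct.map_tmul, LinearMap.mul_apply']
    rw [LieSuperalgebra.skew hv hu, TensorProduct.neg_tmul, TensorProduct.smul_tmul', mul_comm]
  jacobi := by
    intro i j x y hx hy w
    let T := TensorProduct.map₂ (bracket (L := g)) (LinearMap.mul ℂ B)
    suffices h : ∀ v ∈ part (V := g) i, ∀ b : B,
        T (v ⊗ₜ b) (T y w) = T (T (v ⊗ₜ b) y) w + sgn i j • T y (T (v ⊗ₜ b) w) from
      part_tensor_le (q := LinearMap.eqLocus (T.flip (T y w))
        (T.flip w ∘ₗ T.flip y + sgn i j • (T y ∘ₗ T.flip w))) h hx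
    intro v hv b
    suffices h : ∀ u ∈ part (V := g) j, ∀ c : B, T (v ⊗ₜ b) (T (u ⊗ₜ c) w) =
        T (T (v ⊗ₜ b) (u ⊗ₜ c)) w + sgn i j • T (u ⊗ₜ c) (T (v ⊗ₜ b) w) from
      part_tensor_le (q := LinearMap.eqLocus (T (v ⊗ₜ b) ∘ₗ T.flip w)
        (T.flip w ∘ₗ T (v ⊗ₜ b) + sgn i j • T.flip (T (v ⊗ₜ b) w))) h hy
    intro u hu c
    induction w using TensorProduct.induction_on with
    | zero => simp
    | add w₁ w₂ h₁ h₂ =>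
      simp only [map_add, h₁, h₂, smul_add]
      abel
    | tmul t e =>
      simp only [T, TensorProduct.map₂_apply_tmul, TensorProduct.map_tmul, LinearMap.mul_apply']
      rw [LieSuperalgebra.jacobi hv hu, TensorProduct.add_tmul, TensorProduct.smul_tmul',
        mul_assoc, mul_left_comm c b e]

@[simp] theorem bracket_tmul {B : Type*} [CommRing B] [Algebra ℂ B] (x y : g) (a b : B) :
    bracket (x ⊗ₜ[ℂ] a) (y ⊗ₜ[ℂ] b) = bracket x y ⊗ₜ[ℂ] (a * b) := rfl

variable {g} {A : Type*} [CommRing A] [Algebra ℂ A] {Γ : Type*} [Group Γ]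

/-- The action of `Γ` on `g ⊗ A`, `γ (x ⊗ a) = γ x ⊗ γ a`. -/
def mapAction (α : Γ →* LieSuperAut g) (β : Γ →* (A ≃ₐ[ℂ] A)) (γ : Γ) :
    g ⊗[ℂ] A →ₗ[ℂ] g ⊗[ℂ] A :=
  TensorProduct.map ((α γ : g ≃ₗ[ℂ] g) : g →ₗ[ℂ] g) (β γ).toLinearMap

theorem mapAction_bracket (α : Γ →* LieSuperAut g) (β : Γ →* (A ≃ₐ[ℂ] A)) (γ : Γ)
    (x y : g ⊗[ℂ] A) :
    mapAction α β γ (bracket x y) = bracket (mapAction α β γ x) (mapAction α β γ y) := by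
  induction x using TensorProduct.induction_on with
  | zero => simp
  | add x₁ x₂ h₁ h₂ => simp only [map_add, LinearMap.add_apply, h₁, h₂]
  | tmul x a =>
    induction y using TensorProduct.induction_on with
    | zero => simp
    | add y₁ y₂ h₁ h₂ => simp only [map_add, h₁, h₂]
    | tmul y b => simp [mapAction, (α γ).2.2 x y]

theorem mapAction_mem (α : Γ →* LieSuperAut g) (β : Γ →* (A ≃ₐ[ℂ] A)) (γ : Γ) {z : ZMod 2}
    {x : g ⊗[ℂ] A} (hx : x ∈ part (V := g ⊗[ℂ] A) z) :
    mapAction α β γ x ∈ part (V := g ⊗[ℂ] A) z :=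
  part_tensor_le (q := (part (V := g ⊗[ℂ] A) z).comap (mapAction α β γ))
    (fun v hv _ => tmul_mem_part (((α γ).2.1 z v).2 hv) _) hx

theorem proj_mapAction (α : Γ →* LieSuperAut g) (β : Γ →* (A ≃ₐ[ℂ] A)) (γ : Γ) (z : ZMod 2)
    (x : g ⊗[ℂ] A) : proj z (mapAction α β γ x) = mapAction α β γ (proj z x) := by
  suffices h : proj z ∘ₗ mapAction α β γ = mapAction α β γ ∘ₗ proj z from LinearMap.congr_fun h x
  refine hom_ext fun w v hv => ?_
  by_cases h : z = w
  · subst h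
    simp [proj_of_mem hv, proj_of_mem (mapAction_mem α β γ hv)]
  · simp [proj_of_mem_ne h hv, proj_of_mem_ne h (mapAction_mem α β γ hv)]

/-- The underlying space of the equivariant map superalgebra `(g ⊗ A)^Γ`: the `Γ`-fixed points. -/
def fixedPoints (α : Γ →* LieSuperAut g) (β : Γ →* (A ≃ₐ[ℂ] A)) : Submodule ℂ (g ⊗[ℂ] A) where
  carrier := {x | ∀ γ, mapAction α β γ x = x}
  zero_mem' := by simp
  add_mem' := by intro x y hx hy γ; rw [map_add, hx γ, hy γ]
  smul_mem' := by intro c x hx γ; rw [map_smul, hx γ]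

theorem bracket_mem_fixedPoints (α : Γ →* LieSuperAut g) (β : Γ →* (A ≃ₐ[ℂ] A))
    (x y : fixedPoints α β) : bracket (x : g ⊗[ℂ] A) (y : g ⊗[ℂ] A) ∈ fixedPoints α β := by
  intro γ
  rw [mapAction_bracket, x.2 γ, y.2 γ]

/-- The equivariant map superalgebra `(g ⊗ A)^Γ`, a Lie subsuperalgebra of `g ⊗ A`. -/
instance equivariantMapSuperalgebra (α : Γ →* LieSuperAut g) (β : Γ →* (A ≃ₐ[ℂ] A)) :
    LieSuperalgebra (fixedPoints α β) where
  part z := (part (V := g ⊗[ℂ] A) z).comap (fixedPoints α β).subtype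
  isCompl := by
    refine ⟨Submodule.disjoint_def.2 fun x h1 h2 => Subtype.ext ?_,
      codisjoint_iff_le_sup.2 fun x _ => ?_⟩
    · exact Submodule.disjoint_def.1 (SuperSpace.isCompl (V := g ⊗[ℂ] A)).disjoint _ h1 h2
    · have h (z : ZMod 2) : proj z (x : g ⊗[ℂ] A) ∈ fixedPoints α β := fun γ => by
        rw [← proj_mapAction, x.2 γ]
      refine Submodule.mem_sup.2 ⟨⟨_, h 0⟩, proj_mem (V := g ⊗[ℂ] A) 0 x,
        ⟨_, h 1⟩, proj_mem (V := g ⊗[ℂ] A) 1 x, ?_⟩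
      exact Subtype.ext (proj_add_proj _)
  bracket := LinearMap.mk₂ ℂ (fun x y => ⟨_, bracket_mem_fixedPoints α β x y⟩)
    (fun _ _ _ => Subtype.ext (by simp)) (fun _ _ _ => Subtype.ext (by simp))
    (fun _ _ _ => Subtype.ext (by simp)) (fun _ _ _ => Subtype.ext (by simp))
  bracket_mem hx hy := LieSuperalgebra.bracket_mem (L := g ⊗[ℂ] A) hx hy
  skew hx hy := Subtype.ext (LieSuperalgebra.skew (L := g ⊗[ℂ] A) hx hy)
  jacobi hx hy w := Subtype.ext (LieSuperalgebra.jacobi (L := g ⊗[ℂ] A) hx hy (w : g ⊗[ℂ] A))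

/-- Reduction modulo an ideal `I`, restricted to the fixed points: the homomorphism
`(g ⊗ A)^Γ → g ⊗ A/I`, `x ⊗ a ↦ x ⊗ (a + I)`. -/
def ev (α : Γ →* LieSuperAut g) (β : Γ →* (A ≃ₐ[ℂ] A)) (I : Ideal A) :
    LieSuperHom (fixedPoints α β) (g ⊗[ℂ] (A ⧸ I)) where
  toLinearMap := TensorProduct.map LinearMap.id (Ideal.Quotient.mkₐ ℂ I).toLinearMap ∘ₗ
    (fixedPoints α β).subtype
  map_mem := by
    intro z x hx
    exact part_tensor_le (q := (part (V := g ⊗[ℂ] (A ⧸ I)) z).comap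
      (TensorProduct.map LinearMap.id (Ideal.Quotient.mkₐ ℂ I).toLinearMap))
      (fun v hv _ => tmul_mem_part hv _) hx
  map_bracket := by
    rintro ⟨x, hx⟩ ⟨y, hy⟩
    change TensorProduct.map LinearMap.id (Ideal.Quotient.mkₐ ℂ I).toLinearMap (bracket x y) =
      bracket (TensorProduct.map LinearMap.id (Ideal.Quotient.mkₐ ℂ I).toLinearMap x)
        (TensorProduct.map LinearMap.id (Ideal.Quotient.mkₐ ℂ I).toLinearMap y)
    clear hx hy
    induction x using TensorProduct.induction_on with
    | zero => simp
    | add x₁ x₂ h₁ h₂ => simp only [map_add, LinearMap.add_apply, h₁, h₂]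
    | tmul x a =>
      induction y using TensorProduct.induction_on with
      | zero => simp
      | add y₁ y₂ h₁ h₂ => simp only [map_add, h₁, h₂]
      | tmul y b => simp

/-- The generalized evaluation module `ev^Γ_I V`: the pull-back to `(g ⊗ A)^Γ` of a
`g ⊗ A/I`-module. -/
def evModule (α : Γ →* LieSuperAut g) (β : Γ →* (A ≃ₐ[ℂ] A)) (I : Ideal A)
    {V : Type*} [AddCommGroup V] [Module ℂ V] [SuperSpace V]
    (ρ : SuperRep (g ⊗[ℂ] (A ⧸ I)) V) : SuperRep (fixedPoints α β) V :=
  ρ.pullback (ev α β I)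

/-- The action `γ 𝔪 = {γ a | a ∈ 𝔪}` of `Γ` on the maximal ideals of `A` is free. -/
def ActsFreely (β : Γ →* (A ≃ₐ[ℂ] A)) : Prop :=
  ∀ (γ : Γ) (m : MaximalSpectrum A), m.asIdeal.map (β γ) = m.asIdeal → γ = 1

/-- The maximal ideals `m` and `m'` lie in the same `Γ`-orbit. -/
def SameOrbit (β : Γ →* (A ≃ₐ[ℂ] A)) (m m' : MaximalSpectrum A) : Prop :=
  ∃ γ : Γ, m.asIdeal.map (β γ) = m'.asIdeal

end Map

end

end EquivMap

/-! Write `L` for the fixed-point algebra, `I` for the intersection of all translates of the ideals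
`m_k ^ n_k`, and `K` for the fixed points in `g ⊗ I`; `K` acts by zero on every factor. Freeness and
distinctness of orbits make the translates pairwise coprime, so there are invariant functions `e_k`
equal to 1 modulo the translates of the `k`-th ideal and to 0 modulo the others. Multiplication `ε
k` by `e_k` preserves `L`, and `ε k x` acts on the tensor product through its `k`-th factor only.

Let `f` be a cocycle and let the factors `i`, `j` have no invariants. On `K` the cocycle identity
reads `f [x, y] = x f(y)`, so `f` kills `[K, K]`, which contains all fixed points in `g ⊗ I²`
(`ActsFreely.fixedIdeal_mul_le`, from a Galois element for the free action and `g = [g, g]`). Since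
`e_k (1 - e_k)` and `e_i e_j` lie in `I`, absence of invariants gives `f(y) = f(ε i y) = f(ε j (ε i
y)) = 0` on `K`.

Now `[ε i x, ε j y]` lies in `K`, so up to signs `x` on factor `i` applied to `f(ε j y)` equals `y`
on factor `j` applied to `f(ε i x)`. Having no invariants, the operators on factor `j` generate the
unit left ideal; inverting them yields `t` with `f(ε i x) = (ε i x) t`
(`Separating.exists_cocycle_eq`). After subtracting `d₀ t`, the cocycle vanishes on the image of `ε
i`, and absence of invariants in factor `i` makes it vanish everywhere. -/

namespace EquivMap

noncomputable section

open SuperSpace (part)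
open LieSuperalgebra (bracket)

/-! ### Operators on one tensor factor -/

section LeftInverse

variable {L V : Type*} [AddCommGroup L] [Module ℂ L] [AddCommGroup V] [Module ℂ V]
  [FiniteDimensional ℂ V]

/-- If the operators `P x` have no common kernel, then the left ideal they generate is
everything. -/
theorem exists_sum_mul_eq_one (P : L →ₗ[ℂ] Module.End ℂ V)
    (h : ∀ v, (∀ x, P x v = 0) → v = 0) :
    ∃ (r : ℕ) (R : Fin r → Module.End ℂ V) (x : Fin r → L), ∑ s, R s * P (x s) = 1 := by
  -- Finitely many operators span the range of `P`. Together they embed `V` into a power of `V`, and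
  -- the components of a linear left inverse are the `R s`.
  let b := Module.finBasis ℂ (LinearMap.range P)
  choose x hx using fun s => (b s).2
  let Φ : V →ₗ[ℂ] (Fin (Module.finrank ℂ (LinearMap.range P)) → V) :=
    LinearMap.pi fun s => P (x s)
  have hΦ : LinearMap.ker Φ = ⊥ := by
    refine LinearMap.ker_eq_bot'.2 fun v hv => h v fun y => ?_
    have h1 : ∀ T : LinearMap.range P, (T : Module.End ℂ V) v = 0 := by
      intro T
      rw [← b.sum_repr T]
      simp only [Submodule.coe_sum, Submodule.coe_smul, LinearMap.sum_apply, LinearMap.smul_apply]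
      refine Finset.sum_eq_zero fun s _ => ?_
      rw [← hx s, show P (x s) v = 0 from congrFun hv s, smul_zero]
    exact h1 ⟨P y, y, rfl⟩
  obtain ⟨Ψ, hΨ⟩ := LinearMap.exists_leftInverse_of_injective Φ hΦ
  refine ⟨_, fun s => Ψ ∘ₗ LinearMap.single ℂ (fun _ => V) s, x, ?_⟩
  ext v
  have h2 := LinearMap.congr_fun hΨ v
  simp only [LinearMap.sum_apply, Module.End.mul_apply, LinearMap.comp_apply,
    LinearMap.single_apply, ← map_sum] at h2 ⊢
  rw [show (∑ s, Pi.single s (P (x s) v)) = Φ v from Finset.univ_sum_single (Φ v), h2]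
  rfl

end LeftInverse

theorem signOp_zero {V : Type*} [AddCommGroup V] [Module ℂ V] [SuperSpace V] :
    (signOp 0 : Module.End ℂ V) = 1 :=
  hom_ext fun _ v hv => by simp [signOp_of_mem 0 hv]

section Slot

variable {ℓ : ℕ} {V : Fin ℓ → Type*} [∀ i, AddCommGroup (V i)] [∀ i, Module ℂ (V i)]
  [∀ i, SuperSpace (V i)]

theorem slot_zero_one (k : Fin ℓ) : slot (V := V) 0 k 1 = 1 := by
  rw [slot_apply, ← PiTensorProduct.map_one]
  congr 1
  ext1 j
  by_cases h : j = k
  · subst h; simp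
  · simp [h, signOp_zero]

/-- `slot z k 1` is the bare Koszul sign on the factors before `k`; being an involution, it strips
the sign from `slot z k a` and can restore it. -/
theorem slot_one_mul_self (z : ZMod 2) (k : Fin ℓ) :
    slot (V := V) z k 1 * slot z k 1 = 1 := by
  rw [slot_mul_same, show z + z = 0 by revert z; decide, mul_one, slot_zero_one]

theorem slot_one_mul (z : ZMod 2) (k : Fin ℓ) (a : Module.End ℂ (V k)) :
    slot z k 1 * slot 0 k a = slot z k a := by
  rw [slot_mul_same, add_zero, one_mul]

theorem slot_one_mul_slot (z : ZMod 2) (k : Fin ℓ) (a : Module.End ℂ (V k)) :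
    slot z k 1 * slot z k a = slot 0 k a := by
  rw [slot_mul_same, show z + z = 0 by revert z; decide, one_mul]

theorem slot_zero_comm {k l : Fin ℓ} (hkl : k < l) (a : Module.End ℂ (V k))
    (b : Module.End ℂ (V l)) : slot 0 l b * slot 0 k a = slot 0 k a * slot 0 l b := by
  rw [slot_comm_of_lt 0 0 hkl a b (by simp [signOp_zero])]
  simp

end Slot

/-! ### A vanishing criterion for the first cohomology -/

section Vanishing

variable {L : Type*} [AddCommGroup L] [Module ℂ L] [LieSuperalgebra L]

/-- A cocycle with values in a module on which `y` and its homogeneous components act by zero. -/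
theorem twistedAct_eq_zero {V : Type*} [AddCommGroup V] [Module ℂ V] [SuperSpace V]
    (ρ : SuperRep L V) (f : L →ₗ[ℂ] V) (x : L) {y : L} (hy : ∀ z, ρ.act (proj z y) = 0) :
    twistedAct ρ f x y = 0 := by
  simp [twistedAct, hy]

/-- With the signs packed into `twistedAct`, the cocycle identity needs no homogeneity. -/
theorem cocycle_apply {V : Type*} [AddCommGroup V] [Module ℂ V] [SuperSpace V]
    {ρ : SuperRep L V} {f : L →ₗ[ℂ] V} (hf : d₁ ρ f = 0) (x y : L) :
    f (bracket x y) = ρ.act x (f y) - twistedAct ρ f x y := by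
  have h : d₁Fun ρ f x y = 0 := by
    rw [show d₁Fun ρ f = 0 from congrArg Subtype.val hf]; rfl
  simp only [d₁Fun, LinearMap.sub_apply, LinearMap.compl₂_apply, LinearMap.compr₂_apply] at h
  exact (sub_eq_zero.1 h).symm

variable {ℓ : ℕ} {V : Fin ℓ → Type*} [∀ i, AddCommGroup (V i)] [∀ i, Module ℂ (V i)]
  [∀ i, SuperSpace (V i)]

/-- A vector killed by the action on a factor without invariants is zero. -/
theorem eq_zero_of_slot_eq_zero {k : Fin ℓ} [FiniteDimensional ℂ (V k)] (ρ : SuperRep L (V k))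
    (h : ∀ v, (∀ x, ρ.act x v = 0) → v = 0) {t : ⨂[ℂ] i, V i}
    (ht : ∀ z, ∀ x ∈ part (V := L) z, slot z k (ρ.act x) t = 0) : t = 0 := by
  obtain ⟨r, R, x, hR⟩ := exists_sum_mul_eq_one ρ.act h
  -- The sign operator turns `slot z` into `slot 0`, which makes the condition linear in `x` across
  -- parities.
  have h1 : ((slot 0 k).flip t ∘ₗ ρ.act : L →ₗ[ℂ] ⨂[ℂ] i, V i) = 0 := by
    refine hom_ext fun z x hx => ?_
    simp only [LinearMap.comp_apply, LinearMap.flip_apply, LinearMap.zero_apply]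
    rw [← slot_one_mul_slot z k, Module.End.mul_apply, ht z x hx, map_zero]
  have h2 : t = slot (V := V) 0 k 1 t := by rw [slot_zero_one]; rfl
  rw [h2, ← hR, map_sum, LinearMap.sum_apply]
  refine Finset.sum_eq_zero fun s _ => ?_
  rw [← add_zero (0 : ZMod 2), ← slot_mul_same, Module.End.mul_apply,
    show slot 0 k (ρ.act (x s)) t = 0 from LinearMap.congr_fun h1 (x s), map_zero]

/-- Central even operators `ε k` on a Lie superalgebra `L` that, modulo an ideal `K` which acts by
zero on all the modules `V k`, are orthogonal idempotents, such that `ε k x` acts on `V k` as `x`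
and on the other modules as zero. -/
structure Separating (ρ : ∀ k, SuperRep L (V k)) (ε : Fin ℓ → Module.End ℂ L)
    (K : Submodule ℂ L) : Prop where
  proj_mem : ∀ z, ∀ x ∈ K, proj z x ∈ K
  bracket_mem : ∀ x, ∀ y ∈ K, bracket x y ∈ K
  act_eq_zero : ∀ k, ∀ x ∈ K, (ρ k).act x = 0
  map_part : ∀ k z, ∀ x ∈ part (V := L) z, ε k x ∈ part (V := L) z
  bracket_left : ∀ k x y, bracket (ε k x) y = ε k (bracket x y)
  bracket_right : ∀ k x y, bracket x (ε k y) = ε k (bracket x y)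
  act_same : ∀ k x, (ρ k).act (ε k x) = (ρ k).act x
  act_ne : ∀ k l x, l ≠ k → (ρ l).act (ε k x) = 0
  map_mem : ∀ k, ∀ x ∈ K, ε k x ∈ K
  orth : ∀ k l x, k ≠ l → ε k (ε l x) ∈ K
  idem : ∀ k x, ε k (x - ε k x) ∈ K
  -- A multiplier from `I` applied to `K` lands in `g ⊗ I²`; hence these two fields demand
  -- membership in `[K, K]`, where cocycles vanish.
  orth_of_mem : ∀ k l, ∀ x ∈ K, k ≠ l → ε k (ε l x) ∈ Submodule.map₂ bracket K K
  idem_of_mem : ∀ k, ∀ x ∈ K, ε k (x - ε k x) ∈ Submodule.map₂ bracket K K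

namespace Separating

variable {ρ : ∀ k, SuperRep L (V k)} {ε : Fin ℓ → Module.End ℂ L} {K : Submodule ℂ L}

theorem act_tensor_eq_zero (S : Separating ρ ε K) {x : L} (hx : x ∈ K) :
    (tensorRep ρ).act x = 0 := by
  change tensorAct ρ x = 0
  simp only [tensorAct, LinearMap.sum_apply, LinearMap.comp_apply]
  refine Finset.sum_eq_zero fun z _ => Finset.sum_eq_zero fun k _ => ?_
  rw [S.act_eq_zero k _ (S.proj_mem z x hx), map_zero]

theorem act_tensor (S : Separating ρ ε K) (k : Fin ℓ) {z : ZMod 2} {x : L}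
    (hx : x ∈ part (V := L) z) : (tensorRep ρ).act (ε k x) = slot z k ((ρ k).act x) := by
  change tensorAct ρ (ε k x) = _
  rw [tensorAct_apply ρ (S.map_part k z x hx), Finset.sum_eq_single k, S.act_same]
  · intro l _ hl
    rw [S.act_ne k l x hl, map_zero]
  · simp

theorem eq_zero_of_act_eq_zero (S : Separating ρ ε K) {k : Fin ℓ} [FiniteDimensional ℂ (V k)]
    (h : ∀ v, (∀ x, (ρ k).act x v = 0) → v = 0) {t : ⨂[ℂ] i, V i}
    (ht : ∀ z, ∀ x ∈ part (V := L) z, (tensorRep ρ).act (ε k x) t = 0) : t = 0 :=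
  eq_zero_of_slot_eq_zero (ρ k) h fun z x hx => by rw [← S.act_tensor k hx, ht z x hx]

variable {f : L →ₗ[ℂ] ⨂[ℂ] i, V i}

/-- The twisted term contains the action of `y`, which is zero: on `K` a cocycle is equivariant. -/
theorem cocycle_bracket_of_mem (S : Separating ρ ε K) (hf : d₁ (tensorRep ρ) f = 0) (x : L)
    {y : L} (hy : y ∈ K) : f (bracket x y) = (tensorRep ρ).act x (f y) := by
  rw [cocycle_apply hf, twistedAct_eq_zero, sub_zero]
  exact fun z => S.act_tensor_eq_zero (S.proj_mem z y hy)

theorem cocycle_map₂ (S : Separating ρ ε K) (hf : d₁ (tensorRep ρ) f = 0) {x : L}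
    (hx : x ∈ Submodule.map₂ bracket K K) : f x = 0 := by
  refine (Submodule.map₂_le (r := LinearMap.ker f)).2 (fun x hx y hy => ?_) hx
  rw [LinearMap.mem_ker, S.cocycle_bracket_of_mem hf x hy, S.act_tensor_eq_zero hx]
  rfl

/-- By equivariance on `K`, applying `ε k x` to this value gives `f` of `ε k (w - ε k w)` with `w =
[x, y]`. That element lies in `[K, K]`, so the value is invariant in factor `k`. -/
theorem cocycle_sub_eq_zero (S : Separating ρ ε K) (hf : d₁ (tensorRep ρ) f = 0) {k : Fin ℓ}
    [FiniteDimensional ℂ (V k)] (h : ∀ v, (∀ x, (ρ k).act x v = 0) → v = 0) {y : L}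
    (hy : y ∈ K) : f (y - ε k y) = 0 := by
  refine S.eq_zero_of_act_eq_zero h fun z x hx => ?_
  rw [← S.cocycle_bracket_of_mem hf _ (sub_mem hy (S.map_mem k y hy)), S.bracket_left, map_sub,
    S.bracket_right]
  exact S.cocycle_map₂ hf (S.idem_of_mem k _ (S.bracket_mem x y hy))

/-- `f(y) = f(ε i y) = f(ε j (ε i y))`, and the last argument lies in `[K, K]`. -/
theorem cocycle_eq_zero_of_mem [∀ i, FiniteDimensional ℂ (V i)] (S : Separating ρ ε K)
    (hf : d₁ (tensorRep ρ) f = 0) {i j : Fin ℓ} (hij : i ≠ j)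
    (hi : ∀ v, (∀ x, (ρ i).act x v = 0) → v = 0) (hj : ∀ v, (∀ x, (ρ j).act x v = 0) → v = 0)
    {y : L} (hy : y ∈ K) : f y = 0 := by
  have h1 := S.cocycle_sub_eq_zero hf hi hy
  have h2 := S.cocycle_sub_eq_zero hf hj (S.map_mem i y hy)
  rw [map_sub, S.cocycle_map₂ hf (S.orth_of_mem j i y hy hij.symm), sub_zero] at h2
  rwa [map_sub, h2, sub_zero] at h1

/-- The cocycle identity for `ε i x` and `ε j y`, with all signs removed. -/
theorem slot_cocycle [∀ i, FiniteDimensional ℂ (V i)] (S : Separating ρ ε K)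
    (hf : d₁ (tensorRep ρ) f = 0) {i j : Fin ℓ} (hij : i < j)
    (hi : ∀ v, (∀ x, (ρ i).act x v = 0) → v = 0) (hj : ∀ v, (∀ x, (ρ j).act x v = 0) → v = 0)
    {a b : ZMod 2} {x y : L} (hx : x ∈ part (V := L) a) (hy : y ∈ part (V := L) b) :
    slot 0 j ((ρ j).act y) (slot a i 1 (f (ε i x))) =
      slot 0 i ((ρ i).act x) (slot b j 1 (f (ε j y))) := by
  have h1 := cocycle_apply hf (ε i x) (ε j y)
  rw [S.bracket_left, S.bracket_right,
    S.cocycle_eq_zero_of_mem hf hij.ne hi hj (S.orth i j _ hij.ne),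
    twistedAct_apply _ _ (S.map_part i a x hx) (S.map_part j b y hy), S.act_tensor i hx,
    S.act_tensor j hy] at h1
  -- Both sign operators are applied at once; commuting them past the actions produces a second `sgn
  -- a b`, which cancels the one in the cocycle identity.
  have h2 := congrArg (⇑(slot (V := V) a i 1 * slot (V := V) b j 1)) (sub_eq_zero.1 h1.symm)
  have h3 : slot (V := V) a i 1 * slot b j 1 * slot a i ((ρ i).act x) =
      sgn a b • (slot 0 i ((ρ i).act x) * slot b j 1) := by
    rw [mul_assoc, slot_comm_of_lt a b hij _ _ (signOp_mul_act (ρ i) hx b), mul_smul_comm,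
      ← mul_assoc, slot_one_mul_slot]
  have h4 : slot (V := V) a i 1 * slot b j 1 * slot b j ((ρ j).act y) =
      slot 0 j ((ρ j).act y) * slot a i 1 := by
    rw [mul_assoc, slot_one_mul_slot, slot_comm_of_lt a 0 hij _ _ (by simp [signOp_zero])]
    simp
  rw [map_smul, ← Module.End.mul_apply, ← Module.End.mul_apply, h3, h4] at h2
  have h5 := congrArg (sgn a b • ·) h2
  simpa [smul_smul, sgn_mul_self] using h5.symm

theorem exists_cocycle_eq [∀ i, FiniteDimensional ℂ (V i)] (S : Separating ρ ε K)
    (hf : d₁ (tensorRep ρ) f = 0) {i j : Fin ℓ} (hij : i < j)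
    (hi : ∀ v, (∀ x, (ρ i).act x v = 0) → v = 0)
    (hj : ∀ v, (∀ x, (ρ j).act x v = 0) → v = 0) :
    ∃ t, ∀ x, f (ε i x) = (tensorRep ρ).act (ε i x) t := by
  -- `F k x` is `f (ε k x)` with its Koszul sign removed; the sign depends on the parity of `x`,
  -- hence the sum over parities.
  let F (k : Fin ℓ) : L →ₗ[ℂ] ⨂[ℂ] i, V i := ∑ z : ZMod 2, slot z k 1 ∘ₗ f ∘ₗ ε k ∘ₗ proj z
  have hF (k : Fin ℓ) {z : ZMod 2} {x : L} (hx : x ∈ part (V := L) z) :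
      F k x = slot z k 1 (f (ε k x)) := by
    simp only [F, LinearMap.sum_apply, LinearMap.comp_apply]
    rw [Finset.sum_eq_single z, proj_of_mem hx]
    · intro w _ hw; simp [proj_of_mem_ne hw hx]
    · simp
  have hFF : ∀ {a : ZMod 2} {x : L}, x ∈ part (V := L) a → ∀ y,
      slot 0 j ((ρ j).act y) (F i x) = slot 0 i ((ρ i).act x) (F j y) := by
    intro a x hx y
    suffices h : (slot 0 j).flip (F i x) ∘ₗ (ρ j).act = slot 0 i ((ρ i).act x) ∘ₗ F j from
      LinearMap.congr_fun h y
    refine hom_ext fun b y hy => ?_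
    simp only [LinearMap.comp_apply, LinearMap.flip_apply]
    rw [hF i hx, hF j hy, S.slot_cocycle hf hij hi hj hx hy]
  obtain ⟨r, R, y, hR⟩ := exists_sum_mul_eq_one (ρ j).act hj
  -- A solution must satisfy `F j y = y t` on factor `j`, so `∑ R s * y s = 1` forces this value of
  -- `t`.
  refine ⟨∑ s, slot 0 j (R s) (F j (y s)), fun x => ?_⟩
  suffices h : f ∘ₗ ε i = (tensorRep ρ).act.flip (∑ s, slot 0 j (R s) (F j (y s))) ∘ₗ ε i from
    LinearMap.congr_fun h x
  refine hom_ext fun a x hx => ?_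
  simp only [LinearMap.comp_apply, LinearMap.flip_apply]
  have h1 : F i x = slot 0 i ((ρ i).act x) (∑ s, slot 0 j (R s) (F j (y s))) := by
    have h2 : F i x = slot (V := V) 0 j 1 (F i x) := by rw [slot_zero_one]; rfl
    rw [h2, ← hR, map_sum, map_sum, LinearMap.sum_apply]
    refine Finset.sum_congr rfl fun s _ => ?_
    rw [← Module.End.mul_apply (slot 0 i _), ← slot_zero_comm hij, Module.End.mul_apply,
      ← hFF hx, ← Module.End.mul_apply, slot_mul_same, add_zero]
  rw [S.act_tensor i hx, ← slot_one_mul, Module.End.mul_apply, ← h1, hF i hx,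
    ← Module.End.mul_apply, slot_one_mul_self]
  rfl

/-- If two of the modules have no invariants, every cocycle is a coboundary. -/
theorem subsingleton_H1 [∀ i, FiniteDimensional ℂ (V i)] (S : Separating ρ ε K) {i j : Fin ℓ}
    (hij : i < j) (hi : ∀ v, (∀ x, (ρ i).act x v = 0) → v = 0)
    (hj : ∀ v, (∀ x, (ρ j).act x v = 0) → v = 0) : Subsingleton (H1 (tensorRep ρ)) := by
  refine Submodule.Quotient.subsingleton_iff.2 (eq_top_iff.2 ?_)
  rintro ⟨f, hf⟩ -
  obtain ⟨t, ht⟩ := S.exists_cocycle_eq hf hij hi hj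
  refine ⟨t, Subtype.ext (sub_eq_zero.1 ?_).symm⟩
  change f - d₀ (tensorRep ρ) t = 0
  set f' := f - d₀ (tensorRep ρ) t with hf'
  have hc : d₁ (tensorRep ρ) f' = 0 :=
    LinearMap.mem_ker.1 (sub_mem hf (LinearMap.mem_ker.2 (d₁_d₀ (tensorRep ρ) t)))
  have h0 (x : L) : f' (ε i x) = 0 := by
    rw [hf', LinearMap.sub_apply, ht x]; exact sub_self _
  refine hom_ext fun b y hy => ?_
  -- The bracket of `ε i x` with `y - ε i y` lies in `K`, and `f' (ε i x) = 0`, so the cocycle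
  -- identity leaves only the action of `ε i x` on this value.
  have h1 : f' (y - ε i y) = 0 := by
    refine S.eq_zero_of_act_eq_zero hi fun a x hx => ?_
    have h2 := cocycle_apply hc (ε i x) (y - ε i y)
    rw [S.bracket_left, map_sub, S.bracket_right,
      S.cocycle_eq_zero_of_mem hc hij.ne hi hj (S.idem i _),
      twistedAct_apply _ _ (S.map_part i a x hx) (sub_mem hy (S.map_part i b y hy)), h0] at h2
    simpa using h2.symm
  rwa [map_sub, h0, sub_zero] at h1

end Separating

end Vanishing

/-! ### Simple Lie superalgebras are perfect -/

/-- Simplicity only controls graded ideals, so `[L, L]` has to be shown graded before it can be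
identified with `L`. -/
theorem proj_bracket_mem {L : Type*} [AddCommGroup L] [Module ℂ L] [LieSuperalgebra L] (z : ZMod 2)
    {x : L} (hx : x ∈ Submodule.map₂ (bracket (L := L)) ⊤ ⊤) :
    proj z x ∈ Submodule.map₂ (bracket (L := L)) ⊤ ⊤ := by
  have key (i j : ZMod 2) (x y : L) : proj z (bracket (proj i x) (proj j y)) ∈
      Submodule.map₂ (bracket (L := L)) ⊤ ⊤ := by
    have h := LieSuperalgebra.bracket_mem (proj_mem i x) (proj_mem j y)
    by_cases hz : z = i + j
    · rw [hz, proj_of_mem h]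
      exact Submodule.apply_mem_map₂ _ Submodule.mem_top Submodule.mem_top
    · rw [proj_of_mem_ne hz h]
      exact zero_mem _
  refine (Submodule.map₂_le (r := (Submodule.map₂ (bracket (L := L)) ⊤ ⊤).comap (proj z))).2
    (fun x _ y _ => ?_) hx
  rw [Submodule.mem_comap, ← proj_add_proj x, ← proj_add_proj y]
  simp only [map_add, LinearMap.add_apply]
  exact add_mem (add_mem (key _ _ _ _) (key _ _ _ _)) (add_mem (key _ _ _ _) (key _ _ _ _))

theorem IsSimple.map₂_bracket_eq_top {L : Type*} [AddCommGroup L] [Module ℂ L] [LieSuperalgebra L]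
    (h : IsSimple L) : Submodule.map₂ (bracket (L := L)) ⊤ ⊤ = ⊤ := by
  refine (h.2 _ (fun z x hx => proj_bracket_mem z hx) fun x y _ =>
    Submodule.apply_mem_map₂ _ Submodule.mem_top Submodule.mem_top).resolve_left fun h0 => ?_
  obtain ⟨x, y, hxy⟩ := h.1
  refine hxy ((Submodule.mem_bot ℂ).1 (h0 ▸ ?_))
  exact Submodule.apply_mem_map₂ _ Submodule.mem_top Submodule.mem_top

/-! ### Free actions on the maximal spectrum -/

section Free

variable {A : Type*} [CommRing A] [Algebra ℂ A] {Γ : Type*} [Group Γ] (β : Γ →* (A ≃ₐ[ℂ] A))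

theorem apply_apply (σ τ : Γ) (a : A) : β σ (β τ a) = β (σ * τ) a := by
  rw [map_mul]; rfl

theorem apply_inv_apply (σ : Γ) (a : A) : β σ (β σ⁻¹ a) = a := by
  rw [apply_apply, mul_inv_cancel, map_one]; rfl

theorem inv_apply_apply (σ : Γ) (a : A) : β σ⁻¹ (β σ a) = a := by
  rw [apply_apply, inv_mul_cancel, map_one]; rfl

theorem mem_map_iff (σ : Γ) (J : Ideal A) (a : A) : a ∈ J.map (β σ) ↔ β σ⁻¹ a ∈ J := by
  rw [Ideal.mem_map_iff_of_surjective (β σ) (β σ).surjective]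
  refine ⟨?_, fun h => ⟨_, h, apply_inv_apply β σ a⟩⟩
  rintro ⟨b, hb, rfl⟩
  rwa [inv_apply_apply]

variable {β}

/-- The two maps send `p ⊗ q` to `p γ(q)` and to `p q`. If the kernel of the first had proper image
under the second, a maximal ideal `m` would contain it, hence every `y - γ y`, the image of `1 ⊗ y -
γ y ⊗ 1`. Then `γ m = m`, against freeness. -/
theorem ActsFreely.exists_tmul_ne (h : ActsFreely β) {γ : Γ} (hγ : γ ≠ 1) :
    ∃ t : A ⊗[ℂ] A,
      Algebra.TensorProduct.productMap (AlgHom.id ℂ A) (β γ : A →ₐ[ℂ] A) t = 0 ∧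
      Algebra.TensorProduct.productMap (AlgHom.id ℂ A) (β 1 : A →ₐ[ℂ] A) t = 1 := by
  set φ := Algebra.TensorProduct.productMap (AlgHom.id ℂ A) (β γ : A →ₐ[ℂ] A)
  set ψ := Algebra.TensorProduct.productMap (AlgHom.id ℂ A) (β 1 : A →ₐ[ℂ] A) with hψ
  have hsurj : Function.Surjective ψ := fun a => ⟨a ⊗ₜ 1, by simp [hψ]⟩
  suffices htop : (RingHom.ker φ).map ψ = ⊤ by
    obtain ⟨t, ht, ht1⟩ := (Ideal.mem_map_iff_of_surjective ψ hsurj).1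
      (htop ▸ Submodule.mem_top : (1 : A) ∈ (RingHom.ker φ).map ψ)
    exact ⟨t, ht, ht1⟩
  by_contra hne
  obtain ⟨m, hm, hle⟩ := Ideal.exists_le_maximal _ hne
  have hsub (y : A) : y - β γ y ∈ m := by
    have h1 : (1 : A) ⊗ₜ[ℂ] y - β γ y ⊗ₜ[ℂ] (1 : A) ∈ RingHom.ker φ := by
      simp [φ, RingHom.mem_ker]
    simpa [hψ] using hle (Ideal.mem_map_of_mem ψ h1)
  refine hγ (h γ ⟨m, hm⟩ ?_)
  ext y
  rw [mem_map_iff]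
  have h2 := hsub (β γ⁻¹ y)
  rw [apply_inv_apply] at h2
  refine ⟨fun h3 => ?_, fun h3 => ?_⟩
  · simpa using sub_mem h3 h2
  · simpa using add_mem h2 h3

/-- The Galois property of a free action: there are `x_s, y_s` in `A` such that
`∑ x_s γ(y_s)` is `1` for `γ = 1` and `0` otherwise. -/
theorem ActsFreely.exists_tmul [Fintype Γ] [DecidableEq Γ] (h : ActsFreely β) :
    ∃ t : A ⊗[ℂ] A, ∀ γ,
      Algebra.TensorProduct.productMap (AlgHom.id ℂ A) (β γ : A →ₐ[ℂ] A) t =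
        if γ = 1 then 1 else 0 := by
  choose! t ht ht1 using fun γ (hγ : γ ≠ 1) => h.exists_tmul_ne hγ
  -- Each evaluation is a ring homomorphism, so in the product the factor `t γ` kills the value at
  -- `γ`, while all factors have value 1 at the identity.
  refine ⟨∏ γ ∈ Finset.univ.erase 1, t γ, fun γ => ?_⟩
  rw [map_prod]
  by_cases hγ : γ = 1
  · subst hγ
    rw [if_pos rfl]
    exact Finset.prod_eq_one fun γ hγ => ht1 γ (Finset.ne_of_mem_erase hγ)
  · rw [if_neg hγ]
    exact Finset.prod_eq_zero (Finset.mem_erase.2 ⟨hγ, Finset.mem_univ γ⟩) (ht γ hγ)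

end Free

/-! ### Multiplication by functions, and the trace to the fixed points -/

section Trace

variable {g : Type*} [AddCommGroup g] [Module ℂ g] {A : Type*} [CommRing A] [Algebra ℂ A]

/-- Multiplication by `a` on `g ⊗ A`. -/
def mulOp (a : A) : Module.End ℂ (g ⊗[ℂ] A) := LinearMap.lTensor g (LinearMap.mulLeft ℂ a)

@[simp] theorem mulOp_tmul (a b : A) (x : g) : mulOp a (x ⊗ₜ[ℂ] b) = x ⊗ₜ (a * b) := rfl

theorem mulOp_mul (a b : A) (x : g ⊗[ℂ] A) : mulOp (a * b) x = mulOp a (mulOp b x) := by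
  induction x using TensorProduct.induction_on with
  | zero => simp
  | add x y hx hy => simp only [map_add, hx, hy]
  | tmul x c => simp [mul_assoc]

theorem mulOp_one_sub (a : A) (x : g ⊗[ℂ] A) : mulOp (1 - a) x = x - mulOp a x := by
  induction x using TensorProduct.induction_on with
  | zero => simp
  | add x y hx hy => simp only [map_add, hx, hy]; abel
  | tmul x c => simp [sub_mul, TensorProduct.tmul_sub]

/-- The subspace `g ⊗ I` of `g ⊗ A`, for an ideal `I`. -/
def idealPart (g : Type*) [AddCommGroup g] [Module ℂ g] (I : Ideal A) : Submodule ℂ (g ⊗[ℂ] A) :=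
  Submodule.map₂ (TensorProduct.mk ℂ g A) ⊤ (I.restrictScalars ℂ)

theorem tmul_mem_idealPart {I : Ideal A} (x : g) {a : A} (ha : a ∈ I) :
    x ⊗ₜ[ℂ] a ∈ idealPart g I :=
  Submodule.apply_mem_map₂ _ Submodule.mem_top ha

theorem idealPart_le {I : Ideal A} {q : Submodule ℂ (g ⊗[ℂ] A)}
    (h : ∀ x : g, ∀ a ∈ I, x ⊗ₜ[ℂ] a ∈ q) : idealPart g I ≤ q :=
  Submodule.map₂_le.2 fun x _ a ha => h x a ha

theorem mulOp_mem_idealPart {I : Ideal A} {a : A} (ha : a ∈ I) (x : g ⊗[ℂ] A) :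
    mulOp a x ∈ idealPart g I := by
  induction x using TensorProduct.induction_on with
  | zero => simp
  | add x y hx hy => rw [map_add]; exact add_mem hx hy
  | tmul x c => exact tmul_mem_idealPart x (I.mul_mem_right c ha)

theorem mulOp_mem_idealPart_mul {I J : Ideal A} {a : A} (ha : a ∈ I) {x : g ⊗[ℂ] A}
    (hx : x ∈ idealPart g J) : mulOp a x ∈ idealPart g (I * J) :=
  idealPart_le (q := (idealPart g (I * J)).comap (mulOp a))
    (fun x _ hc => tmul_mem_idealPart x (Ideal.mul_mem_mul ha hc)) hx

theorem mulOp_mem_of_mem {J : Ideal A} (a : A) {x : g ⊗[ℂ] A}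
    (hx : x ∈ idealPart g J) : mulOp a x ∈ idealPart g J :=
  idealPart_le (q := (idealPart g J).comap (mulOp a))
    (fun x _ hc => tmul_mem_idealPart x (J.mul_mem_left a hc)) hx

/-- Reduction modulo `I` on `g ⊗ A`. -/
abbrev reduce (g : Type*) [AddCommGroup g] [Module ℂ g] (I : Ideal A) :
    g ⊗[ℂ] A →ₗ[ℂ] g ⊗[ℂ] (A ⧸ I) :=
  TensorProduct.map LinearMap.id (Ideal.Quotient.mkₐ ℂ I).toLinearMap

theorem reduce_eq_zero {I : Ideal A} {x : g ⊗[ℂ] A} (hx : x ∈ idealPart g I) :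
    reduce g I x = 0 := by
  refine idealPart_le (q := LinearMap.ker (reduce g I)) (fun x a ha => ?_) hx
  rw [LinearMap.mem_ker, TensorProduct.map_tmul]
  simp [Ideal.Quotient.eq_zero_iff_mem.2 ha]

theorem reduce_mulOp_of_one_sub_mem {I : Ideal A} {a : A} (ha : 1 - a ∈ I) (x : g ⊗[ℂ] A) :
    reduce g I (mulOp a x) = reduce g I x := by
  have h := reduce_eq_zero (mulOp_mem_idealPart ha x)
  rw [mulOp_one_sub, map_sub] at h
  exact (sub_eq_zero.1 h).symm

/-! ### Brackets, gradings and traces on `g ⊗ A` -/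

section Super

variable {g : Type*} [AddCommGroup g] [Module ℂ g] [LieSuperalgebra g]

theorem proj_tmul (z : ZMod 2) (x : g) (a : A) : proj z (x ⊗ₜ[ℂ] a) = proj z x ⊗ₜ[ℂ] a := by
  suffices h : proj z ∘ₗ (TensorProduct.mk ℂ g A).flip a =
      (TensorProduct.mk ℂ g A).flip a ∘ₗ proj z from LinearMap.congr_fun h x
  refine hom_ext fun w v hv => ?_
  have hva := tmul_mem_part hv a
  by_cases h : z = w
  · subst h
    simp [proj_of_mem hv, proj_of_mem hva]
  · simp [proj_of_mem_ne h hv, proj_of_mem_ne h hva]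

theorem proj_mem_idealPart (z : ZMod 2) {I : Ideal A} {x : g ⊗[ℂ] A} (hx : x ∈ idealPart g I) :
    proj z x ∈ idealPart g I := by
  refine idealPart_le (q := (idealPart g I).comap (proj z)) (fun x a ha => ?_) hx
  rw [Submodule.mem_comap, proj_tmul]
  exact tmul_mem_idealPart _ ha

theorem bracket_mem_idealPart {I : Ideal A} (x : g ⊗[ℂ] A) {y : g ⊗[ℂ] A}
    (hy : y ∈ idealPart g I) : bracket x y ∈ idealPart g I := by
  refine idealPart_le (q := (idealPart g I).comap (bracket x)) (fun y b hb => ?_) hy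
  rw [Submodule.mem_comap]
  induction x using TensorProduct.induction_on with
  | zero => simp
  | add x y hx hy => rw [map_add, LinearMap.add_apply]; exact add_mem hx hy
  | tmul x a => exact tmul_mem_idealPart _ (I.mul_mem_left a hb)

theorem bracket_mulOp_left (a : A) (x y : g ⊗[ℂ] A) :
    bracket (mulOp a x) y = mulOp a (bracket x y) := by
  induction x using TensorProduct.induction_on with
  | zero => simp
  | add x₁ x₂ h₁ h₂ => simp only [map_add, LinearMap.add_apply, h₁, h₂]
  | tmul x b =>
    induction y using TensorProduct.induction_on with
    | zero => simp
    | add y₁ y₂ h₁ h₂ => simp only [map_add, h₁, h₂]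
    | tmul y c => simp [mul_assoc]

theorem bracket_mulOp_right (a : A) (x y : g ⊗[ℂ] A) :
    bracket x (mulOp a y) = mulOp a (bracket x y) := by
  induction x using TensorProduct.induction_on with
  | zero => simp
  | add x₁ x₂ h₁ h₂ => simp only [map_add, LinearMap.add_apply, h₁, h₂]
  | tmul x b =>
    induction y using TensorProduct.induction_on with
    | zero => simp
    | add y₁ y₂ h₁ h₂ => simp only [map_add, h₁, h₂]
    | tmul y c => simp [mul_left_comm]

theorem mulOp_mem_part (a : A) {z : ZMod 2} {x : g ⊗[ℂ] A} (hx : x ∈ part (V := g ⊗[ℂ] A) z) :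
    mulOp a x ∈ part (V := g ⊗[ℂ] A) z :=
  part_tensor_le (q := (part (V := g ⊗[ℂ] A) z).comap (mulOp a))
    (fun _ hv _ => tmul_mem_part hv _) hx

variable {Γ : Type*} [Group Γ] (α : Γ →* LieSuperAut g) (β : Γ →* (A ≃ₐ[ℂ] A))

@[simp] theorem mapAction_tmul (γ : Γ) (x : g) (a : A) :
    mapAction α β γ (x ⊗ₜ a) = (α γ : g ≃ₗ[ℂ] g) x ⊗ₜ β γ a := rfl

theorem mapAction_mul (σ τ : Γ) (x : g ⊗[ℂ] A) :
    mapAction α β (σ * τ) x = mapAction α β σ (mapAction α β τ x) := by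
  induction x using TensorProduct.induction_on with
  | zero => simp
  | add x y hx hy => simp only [map_add, hx, hy]
  | tmul x a => simp

theorem mapAction_mulOp (γ : Γ) (a : A) (x : g ⊗[ℂ] A) :
    mapAction α β γ (mulOp a x) = mulOp (β γ a) (mapAction α β γ x) := by
  induction x using TensorProduct.induction_on with
  | zero => simp
  | add x y hx hy => simp only [map_add, hx, hy]
  | tmul x b => simp

/-- Multiplication by an invariant function on the fixed points. -/
def fixedMulOp {a : A} (ha : ∀ γ, β γ a = a) : Module.End ℂ (fixedPoints α β) :=
  (mulOp a).restrict fun x hx γ => by rw [mapAction_mulOp, ha, hx γ]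

/-- The trace `x ↦ ∑ γ, γ x`, from `g ⊗ A` to the fixed points. -/
def trace [Fintype Γ] : g ⊗[ℂ] A →ₗ[ℂ] fixedPoints α β :=
  (∑ γ, mapAction α β γ).codRestrict _ fun x σ => by
    rw [LinearMap.sum_apply, map_sum]
    exact Fintype.sum_equiv (Equiv.mulLeft σ) _ _ fun γ => (mapAction_mul α β σ γ x).symm

variable {β}

theorem coe_trace [Fintype Γ] (x : g ⊗[ℂ] A) :
    (trace α β x : g ⊗[ℂ] A) = ∑ γ, mapAction α β γ x :=
  LinearMap.sum_apply _ _ _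

/-- The fixed points in `g ⊗ I`. -/
def fixedIdeal (β : Γ →* (A ≃ₐ[ℂ] A)) (I : Ideal A) : Submodule ℂ (fixedPoints α β) :=
  (idealPart g I).comap (fixedPoints α β).subtype

theorem trace_mem_fixedIdeal [Fintype Γ] {I : Ideal A} (hI : ∀ γ, ∀ a ∈ I, β γ a ∈ I) (x : g)
    {a : A} (ha : a ∈ I) : trace α β (x ⊗ₜ a) ∈ fixedIdeal α β I := by
  rw [fixedIdeal, Submodule.mem_comap, Submodule.subtype_apply, coe_trace]
  exact Submodule.sum_mem _ fun γ _ => tmul_mem_idealPart _ (hI γ a ha)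

/-- The bracket of the traces of `u ⊗ a p` and `v ⊗ q b` is a double sum over `σ, τ` with
coefficient `σ(a) τ(b) σ(p · (σ⁻¹τ)(q))`. Summed over a Galois element `∑ p ⊗ q`, only `σ = τ`
survives, which leaves the trace of `[u, v] ⊗ a b`. -/
theorem ActsFreely.trace_tmul_mem [Fintype Γ] (h : ActsFreely β) {I : Ideal A}
    (hI : ∀ γ, ∀ a ∈ I, β γ a ∈ I) (u v : g) {a b : A} (ha : a ∈ I) (hb : b ∈ I) :
    trace α β (bracket u v ⊗ₜ (a * b)) ∈
      Submodule.map₂ bracket (fixedIdeal α β I) (fixedIdeal α β I) := by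
  classical
  obtain ⟨t, ht⟩ := h.exists_tmul
  set D := Submodule.map₂ bracket (fixedIdeal α β I) (fixedIdeal α β I)
  have key (t : A ⊗[ℂ] A) : ∑ σ, ∑ τ, bracket ((α σ : g ≃ₗ[ℂ] g) u) ((α τ : g ≃ₗ[ℂ] g) v) ⊗ₜ[ℂ]
      (β σ a * β τ b * β σ (Algebra.TensorProduct.productMap (AlgHom.id ℂ A)
        (β (σ⁻¹ * τ) : A →ₐ[ℂ] A) t)) ∈ D.map (fixedPoints α β).subtype := by
    induction t using TensorProduct.induction_on with
    | zero => simp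
    | add t₁ t₂ h₁ h₂ =>
      simp only [map_add, mul_add, TensorProduct.tmul_add, Finset.sum_add_distrib]
      exact add_mem h₁ h₂
    | tmul p q =>
      refine ⟨bracket (trace α β (u ⊗ₜ (a * p))) (trace α β (v ⊗ₜ (q * b))),
        Submodule.apply_mem_map₂ _ (trace_mem_fixedIdeal α hI u (I.mul_mem_right p ha))
          (trace_mem_fixedIdeal α hI v (I.mul_mem_left q hb)), ?_⟩
      change bracket (trace α β (u ⊗ₜ (a * p)) : g ⊗[ℂ] A)
        (trace α β (v ⊗ₜ (q * b)) : g ⊗[ℂ] A) = _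
      rw [coe_trace, coe_trace, LinearMap.map_sum₂]
      refine Finset.sum_congr rfl fun σ _ => ?_
      rw [map_sum]
      refine Finset.sum_congr rfl fun τ _ => ?_
      have hq : β σ (Algebra.TensorProduct.productMap (AlgHom.id ℂ A)
          (β (σ⁻¹ * τ) : A →ₐ[ℂ] A) (p ⊗ₜ q)) = β σ p * β τ q := by
        rw [Algebra.TensorProduct.productMap_apply_tmul, map_mul (β σ)]
        exact congrArg (β σ p * ·) (by
          change β σ (β (σ⁻¹ * τ) q) = _
          rw [apply_apply, mul_inv_cancel_left])
      rw [mapAction_tmul, mapAction_tmul, bracket_tmul, hq, map_mul (β σ), map_mul (β τ)]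
      congr 1
      ring
  obtain ⟨d, hd, hdt⟩ := key t
  suffices heq : trace α β (bracket u v ⊗ₜ (a * b)) = d from heq ▸ hd
  refine Subtype.ext ?_
  rw [coe_trace]
  refine Eq.trans ?_ hdt.symm
  refine Finset.sum_congr rfl fun σ _ => ?_
  rw [Finset.sum_eq_single σ]
  · rw [ht, if_pos (inv_mul_cancel σ)]
    simp [(α σ).2.2 u v]
  · intro τ _ hτ
    rw [ht, if_neg (fun h => hτ (inv_mul_eq_one.1 h).symm)]
    simp
  · simp

/-- For a free action, `(g ⊗ I²)^Γ` is spanned by brackets of elements of `(g ⊗ I)^Γ`. -/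
theorem ActsFreely.fixedIdeal_mul_le [Finite Γ] (hg : IsSimple g) (h : ActsFreely β) {I : Ideal A}
    (hI : ∀ γ, ∀ a ∈ I, β γ a ∈ I) {x : fixedPoints α β} (hx : (x : g ⊗[ℂ] A) ∈ idealPart g (I * I)) :
    x ∈ Submodule.map₂ bracket (fixedIdeal α β I) (fixedIdeal α β I) := by
  cases nonempty_fintype Γ
  set D := Submodule.map₂ bracket (fixedIdeal α β I) (fixedIdeal α β I)
  -- Perfectness of `g` reduces `w` to brackets, and `c` is a sum of products of elements of `I`.
  have h1 : idealPart g (I * I) ≤ D.comap (trace α β) := by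
    refine idealPart_le fun w c hc => ?_
    have hw : w ∈ Submodule.map₂ (bracket (L := g)) ⊤ ⊤ := by
      rw [hg.map₂_bracket_eq_top]; trivial
    refine Submodule.map₂_le (r := (D.comap (trace α β)).comap
      ((TensorProduct.mk ℂ g A).flip c)) |>.2 (fun u _ v _ => ?_) hw
    rw [Submodule.mem_comap, LinearMap.flip_apply, TensorProduct.mk_apply]
    refine Submodule.mul_induction_on hc (fun a ha b hb => h.trace_tmul_mem α hI u v ha hb)
      fun a b ha hb => ?_
    rw [TensorProduct.tmul_add]
    exact add_mem ha hb
  -- On fixed points the trace is multiplication by the order of `Γ`, invertible in `ℂ`.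
  have h2 : trace α β (x : g ⊗[ℂ] A) = (Fintype.card Γ : ℂ) • x := by
    refine Subtype.ext ?_
    rw [coe_trace, Finset.sum_congr rfl fun γ _ => x.2 γ]
    simp [Finset.card_univ, Nat.cast_smul_eq_nsmul]
  have h3 : (Fintype.card Γ : ℂ) ≠ 0 := Nat.cast_ne_zero.2 Fintype.card_ne_zero
  have h4 := h1 hx
  rw [Submodule.mem_comap, h2] at h4
  exact (Submodule.smul_mem_iff _ h3).1 h4

end Super

end Trace

/-! ### Invariants as homomorphisms from the trivial module -/

/-- A homogeneous invariant `w` yields the homomorphism `c ↦ c w` of the same parity. The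
homogeneous components of an invariant are again invariant, because a homogeneous `x` shifts
parities uniformly. -/
theorem eq_zero_of_moduleHom_eq_bot {L : Type*} [AddCommGroup L] [Module ℂ L] [LieSuperalgebra L]
    {V : Type*} [AddCommGroup V] [Module ℂ V] [SuperSpace V] {ρ : SuperRep L V}
    (h : moduleHom (trivialRep L) ρ = ⊥) {v : V} (hv : ∀ x, ρ.act x v = 0) : v = 0 := by
  have key : ∀ z, ∀ w ∈ part (V := V) z, (∀ x, ρ.act x w = 0) → w = 0 := by
    intro z w hw hx
    have h1 : LinearMap.toSpanSingleton ℂ V w ∈ homPart (trivialRep L) ρ z := by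
      refine ⟨fun j c hc => ?_, fun i x _ c => by simp [trivialRep, hx]⟩
      rcases zmod_cases j with rfl | rfl
      · simpa using Submodule.smul_mem _ c hw
      · have hc : c ∈ (if (1 : ZMod 2) = 0 then ⊤ else ⊥ : Submodule ℂ ℂ) := hc
        rw [if_neg one_ne_zero, Submodule.mem_bot] at hc
        simp [hc]
    have h2 : LinearMap.toSpanSingleton ℂ V w ∈ moduleHom (trivialRep L) ρ := by
      rcases zmod_cases z with rfl | rfl
      · exact Submodule.mem_sup_left h1
      · exact Submodule.mem_sup_right h1
    rw [h, Submodule.mem_bot] at h2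
    simpa using LinearMap.congr_fun h2 1
  have hproj (w : ZMod 2) : proj w v = 0 := by
    refine key w _ (proj_mem w v) fun x => ?_
    suffices h0 : ρ.act.flip (proj w v) = 0 from LinearMap.congr_fun h0 x
    refine hom_ext fun i x hx => ?_
    have h3 : ρ.act x (proj w v) = proj (i + w) (ρ.act x v) := by
      nth_rewrite 2 [← proj_add_proj v]
      rcases zmod_cases w with rfl | rfl
      · rw [map_add, map_add, proj_of_mem (ρ.act_mem hx (proj_mem 0 v)),
          proj_of_mem_ne (by simp) (ρ.act_mem hx (proj_mem 1 v)), add_zero]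
      · rw [map_add, map_add, proj_of_mem (ρ.act_mem hx (proj_mem 1 v)),
          proj_of_mem_ne (by simp) (ρ.act_mem hx (proj_mem 0 v)), zero_add]
    simp [h3, hv x]
  rw [← proj_add_proj v, hproj, hproj, add_zero]

/-! ### Ideals at the points of finitely many orbits -/

section Orbit

variable {A : Type*} [CommRing A] [Algebra ℂ A] {Γ : Type*} [Group Γ] (β : Γ →* (A ≃ₐ[ℂ] A))
  {ℓ : ℕ}

/-- The translate of the `k`-th ideal of a family by `γ`, for `p = (γ, k)`. -/
def orbitIdeal (J : Fin ℓ → Ideal A) (p : Γ × Fin ℓ) : Ideal A := (J p.2).map (β p.1)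

variable {β}

theorem mem_orbitIdeal_one {J : Fin ℓ → Ideal A} {k : Fin ℓ} {a : A} :
    a ∈ orbitIdeal β J (1, k) ↔ a ∈ J k := by
  rw [orbitIdeal, mem_map_iff]
  simp

theorem apply_mem_orbitIdeal {J : Fin ℓ → Ideal A} (σ : Γ) {τ : Γ} {k : Fin ℓ} {a : A} :
    β σ a ∈ orbitIdeal β J (τ, k) ↔ a ∈ orbitIdeal β J (σ⁻¹ * τ, k) := by
  rw [orbitIdeal, orbitIdeal, mem_map_iff, mem_map_iff, apply_apply]
  simp

theorem apply_mem_iInf_orbitIdeal {J : Fin ℓ → Ideal A} (σ : Γ) {a : A}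
    (ha : a ∈ ⨅ p, orbitIdeal β J p) : β σ a ∈ ⨅ p, orbitIdeal β J p := by
  rw [Submodule.mem_iInf] at ha ⊢
  exact fun p => (apply_mem_orbitIdeal σ).2 (ha _)

/-- If `σ m_k = τ m_l`, the orbits agree, so `k = l`, and freeness gives `σ = τ`. Distinct maximal
ideals have coprime powers. -/
theorem ActsFreely.pairwise_isCoprime (h : ActsFreely β) (n : Fin ℓ → ℕ)
    {m : Fin ℓ → MaximalSpectrum A} (hm : ∀ i j, i ≠ j → ¬ SameOrbit β (m i) (m j)) :
    Pairwise (Function.onFun IsCoprime (orbitIdeal β fun i => (m i).asIdeal ^ n i)) := by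
  rintro ⟨σ, k⟩ ⟨τ, l⟩ hne
  simp only [Function.onFun, orbitIdeal, Ideal.map_pow]
  have := (m k).isMaximal
  have := (m l).isMaximal
  refine IsCoprime.pow (Ideal.isCoprime_of_isMaximal fun heq => hne ?_)
  have h1 : (m k).asIdeal.map (β (τ⁻¹ * σ)) = (m l).asIdeal := by
    ext x
    have h2 : β τ x ∈ (m k).asIdeal.map (β σ) ↔ β τ x ∈ (m l).asIdeal.map (β τ) := by rw [heq]
    rw [mem_map_iff, mem_map_iff, inv_apply_apply, apply_apply] at h2
    rw [mem_map_iff, ← h2]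
    simp
  by_cases hkl : k = l
  · subst hkl
    rw [inv_mul_eq_one.1 (h _ _ h1)]
  · exact absurd ⟨_, h1⟩ (hm k l hkl)

theorem exists_mem_orbitIdeal [Finite Γ] {J : Fin ℓ → Ideal A}
    (hJ : Pairwise (Function.onFun IsCoprime (orbitIdeal β J))) (i : Fin ℓ) :
    ∃ e : A, 1 - e ∈ J i ∧ ∀ p, p ≠ (1, i) → e ∈ orbitIdeal β J p := by
  classical
  obtain ⟨e, he⟩ := Ideal.exists_forall_sub_mem_ideal hJ fun p => if p = (1, i) then 1 else 0
  refine ⟨e, ?_, fun p hp => by simpa [hp] using he p⟩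
  rw [← mem_orbitIdeal_one (β := β), ← neg_sub, neg_mem_iff]
  simpa using he (1, i)

/-- Invariant functions which separate the orbits. -/
theorem exists_invariant_mem_orbitIdeal [Finite Γ] {J : Fin ℓ → Ideal A}
    (hJ : Pairwise (Function.onFun IsCoprime (orbitIdeal β J))) (i : Fin ℓ) :
    ∃ e : A, (∀ γ, β γ e = e) ∧ (∀ σ, 1 - e ∈ orbitIdeal β J (σ, i)) ∧
      ∀ σ k, k ≠ i → e ∈ orbitIdeal β J (σ, k) := by
  classical
  cases nonempty_fintype Γ
  obtain ⟨e, he1, he⟩ := exists_mem_orbitIdeal hJ i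
  -- Modulo the translate of `J i` by `σ`, the only nonzero term is the one with `γ = σ`, and it is
  -- 1.
  refine ⟨∑ γ, β γ e, fun σ => ?_, fun σ => ?_, fun σ k hk => ?_⟩
  · rw [map_sum]
    exact Fintype.sum_equiv (Equiv.mulLeft σ) _ _ fun γ => apply_apply β σ γ e
  · rw [← Finset.add_sum_erase _ _ (Finset.mem_univ σ), ← sub_sub]
    refine sub_mem ?_ (Ideal.sum_mem _ fun γ hγ => (apply_mem_orbitIdeal γ).2 (he _ fun h => ?_))
    · rw [← map_one (β σ), ← map_sub, apply_mem_orbitIdeal, inv_mul_cancel, mem_orbitIdeal_one]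
      exact he1
    · exact Finset.ne_of_mem_erase hγ (inv_mul_eq_one.1 (Prod.ext_iff.1 h).1)
  · refine Ideal.sum_mem _ fun γ _ => (apply_mem_orbitIdeal γ).2 (he _ fun h => ?_)
    exact hk (Prod.ext_iff.1 h).2

/-! ### Evaluation maps and the separating operators -/

variable {g : Type*} [AddCommGroup g] [Module ℂ g] [LieSuperalgebra g] (α : Γ →* LieSuperAut g)

theorem ev_apply (I : Ideal A) (x : fixedPoints α β) :
    (ev α β I).toLinearMap x = reduce g I (x : g ⊗[ℂ] A) := rfl

theorem ev_surjective [Finite Γ] {J : Fin ℓ → Ideal A}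
    (hJ : Pairwise (Function.onFun IsCoprime (orbitIdeal β J))) (i : Fin ℓ) :
    Function.Surjective (ev α β (J i)).toLinearMap := by
  cases nonempty_fintype Γ
  obtain ⟨e, he1, he⟩ := exists_mem_orbitIdeal hJ i
  intro y
  change y ∈ LinearMap.range (ev α β (J i)).toLinearMap
  induction y using TensorProduct.induction_on with
  | zero => exact zero_mem _
  | add x y hx hy => exact add_mem hx hy
  | tmul u b =>
    obtain ⟨a, rfl⟩ := Ideal.Quotient.mk_surjective b
    -- `e` is 1 modulo `J i`, and `γ e` lies in `J i` for `γ ≠ 1`, so reduction keeps only the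
    -- identity term of the trace.
    refine ⟨trace α β (u ⊗ₜ (e * a)), ?_⟩
    rw [ev_apply, coe_trace, map_sum, Finset.sum_eq_single 1]
    · rw [mapAction_tmul, map_one, map_one]
      exact reduce_mulOp_of_one_sub_mem he1 (u ⊗ₜ a)
    · intro γ _ hγ
      rw [mapAction_tmul, map_mul]
      refine reduce_eq_zero (tmul_mem_idealPart _ (Ideal.mul_mem_right _ _ ?_))
      rw [← mem_orbitIdeal_one (β := β), apply_mem_orbitIdeal]
      refine he _ fun h => hγ ?_
      simpa using (Prod.ext_iff.1 h).1
    · simp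

theorem ActsFreely.separating [Finite Γ] (hg : IsSimple g) (hfree : ActsFreely β)
    {J : Fin ℓ → Ideal A}
    {V : Fin ℓ → Type*} [∀ i, AddCommGroup (V i)] [∀ i, Module ℂ (V i)] [∀ i, SuperSpace (V i)]
    (ρ : ∀ i, SuperRep (g ⊗[ℂ] (A ⧸ J i)) (V i)) {e : Fin ℓ → A} (he : ∀ i γ, β γ (e i) = e i)
    (he1 : ∀ i σ, 1 - e i ∈ orbitIdeal β J (σ, i))
    (he0 : ∀ i σ k, k ≠ i → e i ∈ orbitIdeal β J (σ, k)) :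
    Separating (fun i => evModule α β (J i) (ρ i)) (fun i => fixedMulOp α β (he i))
      (fixedIdeal α β (⨅ p, orbitIdeal β J p)) := by
  -- On each translate at least one of the two factors vanishes; the same holds for `idem`.
  have orth {k l : Fin ℓ} (hkl : k ≠ l) : e k * e l ∈ ⨅ p, orbitIdeal β J p := by
    refine (Submodule.mem_iInf _).2 fun ⟨σ, i⟩ => ?_
    by_cases hi : i = k
    · exact Ideal.mul_mem_left _ _ (he0 l σ i (hi ▸ hkl))
    · exact Ideal.mul_mem_right _ _ (he0 k σ i hi)
  have idem (k : Fin ℓ) : e k * (1 - e k) ∈ ⨅ p, orbitIdeal β J p := by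
    refine (Submodule.mem_iInf _).2 fun ⟨σ, i⟩ => ?_
    by_cases hi : i = k
    · exact Ideal.mul_mem_left _ _ (hi ▸ he1 i σ)
    · exact Ideal.mul_mem_right _ _ (he0 k σ i hi)
  have coe_idem (k : Fin ℓ) (x : fixedPoints α β) :
      (fixedMulOp α β (he k) (x - fixedMulOp α β (he k) x) : g ⊗[ℂ] A) =
        mulOp (e k * (1 - e k)) (x : g ⊗[ℂ] A) := by
    rw [mulOp_mul, mulOp_one_sub]; rfl
  have coe_orth (k l : Fin ℓ) (x : fixedPoints α β) :
      (fixedMulOp α β (he k) (fixedMulOp α β (he l) x) : g ⊗[ℂ] A) =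
        mulOp (e k * e l) (x : g ⊗[ℂ] A) := by
    rw [mulOp_mul]; rfl
  have hI (γ : Γ) (a : A) (ha : a ∈ ⨅ p, orbitIdeal β J p) := apply_mem_iInf_orbitIdeal γ ha
  constructor
  case proj_mem =>
    intro z x hx
    have hz : ((proj z x : fixedPoints α β) : g ⊗[ℂ] A) = proj z (x : g ⊗[ℂ] A) := by
      suffices h : (fixedPoints α β).subtype ∘ₗ proj z = proj z ∘ₗ (fixedPoints α β).subtype from
        LinearMap.congr_fun h x
      refine hom_ext fun w v hv => ?_
      have hv' : (v : g ⊗[ℂ] A) ∈ part (V := g ⊗[ℂ] A) w := hv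
      by_cases h : z = w
      · subst h
        simp [proj_of_mem hv, proj_of_mem hv']
      · simp [proj_of_mem_ne h hv, proj_of_mem_ne h hv']
    change ((proj z x : fixedPoints α β) : g ⊗[ℂ] A) ∈
      idealPart g (⨅ p, orbitIdeal β J p)
    rw [hz]
    exact proj_mem_idealPart z hx
  case bracket_mem => exact fun x y hy => bracket_mem_idealPart (x : g ⊗[ℂ] A) hy
  case act_eq_zero =>
    intro k x hx
    change (ρ k).act (reduce g (J k) (x : g ⊗[ℂ] A)) = 0
    rw [reduce_eq_zero, map_zero]
    refine idealPart_le (fun x a ha => tmul_mem_idealPart x ?_) hx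
    exact mem_orbitIdeal_one.1 ((Submodule.mem_iInf _).1 ha (1, k))
  case map_part => exact fun k z x hx => mulOp_mem_part (e k) hx
  case bracket_left => exact fun k x y => Subtype.ext (bracket_mulOp_left (e k) _ _)
  case bracket_right => exact fun k x y => Subtype.ext (bracket_mulOp_right (e k) _ _)
  case act_same =>
    intro k x
    change (ρ k).act (reduce g (J k) (mulOp (e k) (x : g ⊗[ℂ] A))) = (ρ k).act (reduce g (J k) x)
    rw [reduce_mulOp_of_one_sub_mem (mem_orbitIdeal_one.1 (he1 k 1))]
  case act_ne =>
    intro k l x hl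
    change (ρ l).act (reduce g (J l) (mulOp (e k) (x : g ⊗[ℂ] A))) = 0
    rw [reduce_eq_zero (mulOp_mem_idealPart (mem_orbitIdeal_one.1 (he0 k 1 l hl)) _), map_zero]
  case map_mem => exact fun k x hx => mulOp_mem_of_mem (e k) hx
  case orth =>
    intro k l x hkl
    change (fixedMulOp α β (he k) (fixedMulOp α β (he l) x) : g ⊗[ℂ] A) ∈
      idealPart g (⨅ p, orbitIdeal β J p)
    rw [coe_orth]
    exact mulOp_mem_idealPart (orth hkl) _
  case idem =>
    intro k x
    change (fixedMulOp α β (he k) (x - fixedMulOp α β (he k) x) : g ⊗[ℂ] A) ∈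
      idealPart g (⨅ p, orbitIdeal β J p)
    rw [coe_idem]
    exact mulOp_mem_idealPart (idem k) _
  case orth_of_mem =>
    intro k l x hx hkl
    refine hfree.fixedIdeal_mul_le α hg hI ?_
    rw [coe_orth]
    exact mulOp_mem_idealPart_mul (orth hkl) hx
  case idem_of_mem =>
    intro k x hx
    refine hfree.fixedIdeal_mul_le α hg hI ?_
    rw [coe_idem]
    exact mulOp_mem_idealPart_mul (idem k) hx

end Orbit

end

end EquivMap

theorem mainTheorem6
    {g : Type*} [AddCommGroup g] [Module ℂ g] [EquivMap.LieSuperalgebra g]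
    [FiniteDimensional ℂ g] (hg : EquivMap.IsSimple g)
    {A : Type*} [CommRing A] [Algebra ℂ A] [Algebra.FiniteType ℂ A]
    {Γ : Type*} [CommGroup Γ] [Finite Γ]
    (α : Γ →* EquivMap.LieSuperAut g) (β : Γ →* (A ≃ₐ[ℂ] A))
    (hfree : EquivMap.ActsFreely β)
    {ℓ : ℕ} (hℓ : 0 < ℓ) (n : Fin ℓ → ℕ) (hn : ∀ i, 0 < n i)
    (m : Fin ℓ → MaximalSpectrum A)
    (hm : ∀ i j, i ≠ j → ¬ EquivMap.SameOrbit β (m i) (m j))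
    (M : Fin ℓ → Type*) [∀ i, AddCommGroup (M i)] [∀ i, Module ℂ (M i)]
    [∀ i, EquivMap.SuperSpace (M i)] [∀ i, FiniteDimensional ℂ (M i)]
    (ρ : ∀ i, EquivMap.SuperRep (g ⊗[ℂ] (A ⧸ (m i).asIdeal ^ n i)) (M i))
    (hM : ∃ i j, i ≠ j ∧
      EquivMap.moduleHom (EquivMap.trivialRep (g ⊗[ℂ] (A ⧸ (m i).asIdeal ^ n i))) (ρ i) = ⊥ ∧
      EquivMap.moduleHom (EquivMap.trivialRep (g ⊗[ℂ] (A ⧸ (m j).asIdeal ^ n j))) (ρ j) = ⊥) :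
    Subsingleton (EquivMap.H1 (EquivMap.tensorRep
      (fun i => EquivMap.evModule α β ((m i).asIdeal ^ n i) (ρ i)))) := by
  have hJ := hfree.pairwise_isCoprime n hm
  choose e he he1 he0 using fun i => EquivMap.exists_invariant_mem_orbitIdeal hJ i
  -- Evaluation is onto, so pulling back creates no new invariants.
  have hinv (i : Fin ℓ)
      (h : EquivMap.moduleHom (EquivMap.trivialRep (g ⊗[ℂ] (A ⧸ (m i).asIdeal ^ n i))) (ρ i) = ⊥)
      (v : M i) (hv : ∀ x, (EquivMap.evModule α β ((m i).asIdeal ^ n i) (ρ i)).act x v = 0) :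
      v = 0 := by
    refine EquivMap.eq_zero_of_moduleHom_eq_bot h fun y => ?_
    obtain ⟨x, rfl⟩ := EquivMap.ev_surjective α hJ i y
    exact hv x
  have S := hfree.separating α hg ρ he he1 he0
  obtain ⟨i, j, hij, hi, hj⟩ := hM
  -- The order of `i` and `j` matters only for the Koszul signs.
  rcases lt_or_gt_of_ne hij with h | h
  · exact S.subsingleton_H1 h (hinv i hi) (hinv j hj)
  · exact S.subsingleton_H1 h (hinv j hj) (hinv i hi)
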